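/- **Setting.** Let $X\subseteq\mathbb R^d$ be open, let $p$ be a positive differentiable probability density on $X$ and $P=p\,dx$. Let $k$ be a symmetric positive semidefinite kernel on $X$ with continuous second-order partial derivatives, in the Stein class of $p$, i.e. $\nabla_x(p(x)k(x,y))$ is integrable in $x$ over $X$ with $\int_X\nabla_x\big(p(x)k(x,y)\big)\,dx=0$ for all $y\in X$. The Stein kernel is $$k_0(x,y)=\nabla\log p(x)^T\nabla\log p(y)\,k(x,y)+\nabla\log p(y)^T\nabla_xk(x,y)+\nabla\log p(x)^T\nabla_yk(x,y)+\sum_{i=1}^d\frac{\partial^2k(x,y)}{\partial x_i\partial y_i}.$$ For a nonempty finite multiset (dictionary) $\mathbf D$ of points of $X$ with empirical measure $q_{\mathbf D}$ put $\mathrm{KSD}(q_{\mathbf D})=\big(|\mathbf D|^{-2}\sum_{x,y\in\mathbf D}k_0(x,y)\big)^{1/2}$. *Thinning.* $\mathrm{KSDT}(\mathbf D,\epsilon,s)$ is computed as follows. Put $M=\mathrm{KSD}(q_{\mathbf D})$. While $\mathrm{KSD}(q_{\mathbf D})^2<M^2+\epsilon$ and $|\mathbf D|>\max(s,1)$: choose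 $x\in\mathbf D$ minimizing $\mathrm{KSD}(q_{\mathbf D\setminus\{x\}})$; if $\mathrm{KSD}(q_{\mathbf D\setminus\{x\}})^2<M^2+\epsilon$, replace $\mathbf D$ by $\mathbf D\setminus\{x\}$, otherwise stop. Return $\mathbf D$. (Ties are broken arbitrarily.) *Online algorithm with horizon $n$.* Start with a fixed finite dictionary $\mathbf D_0$. At step $i=1,\dots,n$, given candidates $y_{i,1},\dots,y_{i,m_i}$ with $m_i=n$, choose $x_i$ among them minimizing $\mathrm{KSD}(q_{\mathbf D_{i-1}\cup\{x_i\}})$ and set $\mathbf D_i=\mathrm{KSDT}(\mathbf D_{i-1}\cup\{x_i\},\epsilon_i,f(i))$. *$V$-uniform ergodicity.* For measurable $V:X\to[1,\infty]$, a Markov transition kernel $K$ on $X$ is $V$-uniformly ergodic (with limit $P$) if there are $R<\infty$, $\rho\in(0,1)$ with $\|K^t(y,\cdot)-P\|_V\le R\,V(y)\rho^t$ for all $y\in X$, $t\ge0$, where $\|\nu\|_V=\sup_{|g|\le V}|\int g\,d\nu|$. Put $V_\pm(s)=\sup\{k_0(x,x)^{1/2}V(x)^{\pm1}:k_0(x,x)\le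 s^2\}$. **Theorem.** Suppose $\mathbb E_{y\sim P}[e^{\gamma k_0(y,y)}]<\infty$ for some $\gamma>0$. Let $K$ be $V$-uniformly ergodic, let $f:\mathbb N\to\mathbb R$ satisfy $f(i)>0$ for $i\ge2$ and $f(i)=\Omega(\sqrt{i\log i})$, let $\epsilon_i=\log(i)/f(i)^2$ (with $\epsilon_1=0$), and let $c>0$, $B<\infty$. Then there is a constant $C>0$, depending on all these data and on $\mathbf D_0$ but not on $n$, such that the following holds for every $n\ge2$. Suppose that for each $i\le n$ the sequence $(y_{i,l})_{l=0}^{n}$ is a Markov chain with transition kernel $K$ whose start satisfies $\mathbb E[V(y_{i,0})]\le B$ and with $\mathbb E[e^{\gamma k_0(y_{i,l},y_{i,l})}]\le B$ for $1\le l\le n$ (both hold with a suitable $B$ if the chains are stationary, $y_{i,0}\sim P$), and that almost surely $|\mathbf D_i|\ge c f(i)$ for all $1\le i\le n$. Then, with $S_i=\sqrt{\tfrac2\gamma\log(n\wedge m_i)}=\sqrt{\tfrac2\gamma\log n}$, $$\mathbb E\big[\mathrm{KSD}(q_{\mathbf D_n})^2\big]\le C\left(\frac{n\log n}{f(n)^2}+\frac1{n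 f(n)^2}\sum_{i=1}^nV_+(S_i)V_-(S_i)\right).$$ -/

import Mathlib

open MeasureTheory ProbabilityTheory
open scoped ENNReal NNReal

noncomputable section

namespace KSDThinning

/-! ### Target density, base kernel, Stein kernel -/

/-- `p` is a positive differentiable probability density on the open domain `X ⊆ ℝᵈ`. -/
structure IsTargetDensity {d : ℕ} (X : Set (EuclideanSpace ℝ (Fin d)))
    (p : EuclideanSpace ℝ (Fin d) → ℝ) : Prop where
  isOpen : IsOpen X
  pos : ∀ x ∈ X, 0 < p x
  differentiableOn : DifferentiableOn ℝ p X
  lintegral_eq_one : ∫⁻ x in X, ENNReal.ofReal (p x) = 1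

/-- The target probability measure on the domain `X`, with density `p` with respect to Lebesgue
measure. -/
def targetMeasure {d : ℕ} (X : Set (EuclideanSpace ℝ (Fin d)))
    (p : EuclideanSpace ℝ (Fin d) → ℝ) : Measure X :=
  (Measure.comap ((↑) : X → EuclideanSpace ℝ (Fin d)) volume).withDensity
    fun x => ENNReal.ofReal (p x)

/-- `k` is a symmetric positive semidefinite kernel on `X` with continuous second-order partial
derivatives. -/
structure IsBaseKernel {d : ℕ} (X : Set (EuclideanSpace ℝ (Fin d)))
    (k : EuclideanSpace ℝ (Fin d) → EuclideanSpace ℝ (Fin d) → ℝ) : Prop where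
  symm : ∀ x ∈ X, ∀ y ∈ X, k x y = k y x
  nonneg : ∀ s : Finset (EuclideanSpace ℝ (Fin d)), (s : Set (EuclideanSpace ℝ (Fin d))) ⊆ X →
    ∀ a : EuclideanSpace ℝ (Fin d) → ℝ, 0 ≤ ∑ x ∈ s, ∑ y ∈ s, a x * a y * k x y
  contDiffOn : ContDiffOn ℝ 2 (Function.uncurry k) (X ×ˢ X)

/-- `k` is in the Stein class of `p` on `X`: for every `y ∈ X`, `∫_X ∇ₓ (p(x) k(x, y)) dx = 0`
(no boundary terms). -/
def InSteinClass {d : ℕ} (X : Set (EuclideanSpace ℝ (Fin d)))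
    (p : EuclideanSpace ℝ (Fin d) → ℝ)
    (k : EuclideanSpace ℝ (Fin d) → EuclideanSpace ℝ (Fin d) → ℝ) : Prop :=
  ∀ y ∈ X, IntegrableOn (fun x => gradient (fun z => p z * k z y) x) X ∧
    ∫ x in X, gradient (fun z => p z * k z y) x = 0

/-- The score function `∇ log p`. -/
def score {d : ℕ} (p : EuclideanSpace ℝ (Fin d) → ℝ) (x : EuclideanSpace ℝ (Fin d)) :
    EuclideanSpace ℝ (Fin d) :=
  gradient (fun z => Real.log (p z)) x

/-- The Stein kernel `k₀` of the density `p` and the base kernel `k`. -/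
def steinKernel {d : ℕ} (p : EuclideanSpace ℝ (Fin d) → ℝ)
    (k : EuclideanSpace ℝ (Fin d) → EuclideanSpace ℝ (Fin d) → ℝ)
    (x y : EuclideanSpace ℝ (Fin d)) : ℝ :=
  inner ℝ (score p x) (score p y) * k x y
    + inner ℝ (score p y) (gradient (fun x' => k x' y) x)
    + inner ℝ (score p x) (gradient (fun y' => k x y') y)
    + ∑ i : Fin d, fderiv ℝ
        (fun x' => fderiv ℝ (fun y' => k x' y') y (EuclideanSpace.single i (1 : ℝ))) x
        (EuclideanSpace.single i (1 : ℝ))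

/-- The Stein kernel restricted to the domain `X`. -/
def steinKernelOn {d : ℕ} (X : Set (EuclideanSpace ℝ (Fin d)))
    (p : EuclideanSpace ℝ (Fin d) → ℝ)
    (k : EuclideanSpace ℝ (Fin d) → EuclideanSpace ℝ (Fin d) → ℝ) (x y : X) : ℝ :=
  steinKernel p k (x : EuclideanSpace ℝ (Fin d)) (y : EuclideanSpace ℝ (Fin d))

/-! ### Kernelized Stein discrepancy and the thinning algorithm

Dictionaries are multisets, since a Markov chain may visit a point repeatedly and each visit
counts in the empirical measure. -/

/-- `KSD(q_D)`, the kernelized Stein discrepancy of the empirical measure of the dictionary `D`. -/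
def ksd {α : Type*} (k₀ : α → α → ℝ) (D : Multiset α) : ℝ :=
  Real.sqrt ((1 / (Multiset.card D : ℝ) ^ 2) * (D.map fun x => (D.map fun y => k₀ x y).sum).sum)

/-- `D'` arises from `D` by removing one copy of a least influential point, that is, of a point
`x ∈ D` that minimizes `KSD(q_{D \ {x}})`. Ties may be broken in any way. -/
def IsLeastInfluentialRemoval {α : Type*} (k₀ : α → α → ℝ) (D D' : Multiset α) : Prop :=
  (∃ x, D = x ::ₘ D') ∧ ∀ (z : α) (E : Multiset α), D = z ::ₘ E → ksd k₀ D' ≤ ksd k₀ E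

/-- The guard of the thinning loop with threshold `T = M² + ε` and minimum size `S`. The last
point is never removed, as the empty dictionary has no empirical measure. -/
def ThinGuard {α : Type*} (k₀ : α → α → ℝ) (T S : ℝ) (D : Multiset α) : Prop :=
  ksd k₀ D ^ 2 < T ∧ max S 1 < (Multiset.card D : ℝ)

/-- `ThinLoop k₀ T S D D'`: the loop of destructive thinning, entered with dictionary `D`,
returns `D'`. -/
inductive ThinLoop {α : Type*} (k₀ : α → α → ℝ) (T S : ℝ) : Multiset α → Multiset α → Prop
  | exit (D : Multiset α) (h : ¬ ThinGuard k₀ T S D) : ThinLoop k₀ T S D D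
  | brk (D E : Multiset α) (h : ThinGuard k₀ T S D) (hE : IsLeastInfluentialRemoval k₀ D E)
      (hT : ¬ ksd k₀ E ^ 2 < T) : ThinLoop k₀ T S D D
  | step (D E D' : Multiset α) (h : ThinGuard k₀ T S D) (hE : IsLeastInfluentialRemoval k₀ D E)
      (hT : ksd k₀ E ^ 2 < T) (hD' : ThinLoop k₀ T S E D') : ThinLoop k₀ T S D D'

/-- `D'` is a possible output of destructive thinning of `D` with budget `ε` and minimum sample
number `S`. -/
def IsKSDT {α : Type*} (k₀ : α → α → ℝ) (D : Multiset α) (ε S : ℝ) (D' : Multiset α) : Prop :=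
  ThinLoop k₀ (ksd k₀ D ^ 2 + ε) S D D'

/-- `x` is a point among the candidates `y 1, …, y m` that minimizes `KSD(D ∪ {·})`. -/
def IsGreedyPoint {α : Type*} (k₀ : α → α → ℝ) (D : Multiset α) (y : ℕ → α) (m : ℕ) (x : α) :
    Prop :=
  (∃ l ∈ Finset.Icc 1 m, x = y l) ∧
    ∀ l ∈ Finset.Icc 1 m, ksd k₀ (x ::ₘ D) ≤ ksd k₀ (y l ::ₘ D)

/-- `D 0, …, D n` are the dictionaries of `n` steps of online thinning started at `D₀`: step `i`
adds a greedy point out of the `m i` candidates `y i 1, …, y i (m i)`, and thins with budget `ε i`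
and minimum size `f i`. -/
def IsOnlineKSDT {α : Type*} (k₀ : α → α → ℝ) (D₀ : Multiset α) (ε f : ℕ → ℝ) (n : ℕ) (m : ℕ → ℕ)
    (y : ℕ → ℕ → α) (D : ℕ → Multiset α) : Prop :=
  D 0 = D₀ ∧ ∀ i ∈ Finset.Icc 1 n, ∃ x, IsGreedyPoint k₀ (D (i - 1)) (y i) (m i) x ∧
    IsKSDT k₀ (x ::ₘ D (i - 1)) (ε i) (f i) (D i)

/-! ### Markov chains and `V`-uniform ergodicity -/

/-- `Z 0, …, Z m` is a time-homogeneous Markov chain with transition kernel `K`: the conditional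
distribution of `Z (l + 1)` given `(Z 0, …, Z l)` is `K (Z l)`. -/
def IsMarkovChain {Ω α : Type*} [MeasurableSpace Ω] [MeasurableSpace α] (μ : Measure Ω)
    (K : Kernel α α) (m : ℕ) (Z : ℕ → Ω → α) : Prop :=
  (∀ l ≤ m, Measurable (Z l)) ∧
    ∀ l < m, HasCondDistrib (Z (l + 1)) (fun ω (j : Fin (l + 1)) => Z j ω)
      (K.comap (fun h : Fin (l + 1) → α => h (Fin.last l)) (measurable_pi_apply _)) μ

/-- The `V`-norm distance `sup_{|g| ≤ V} |∫ g dμ - ∫ g dν|` of two probability measures. The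
supremum over bounded test functions is the same as over all measurable ones for which the
difference makes sense. -/
def vDist {α : Type*} [MeasurableSpace α] (V : α → ℝ≥0∞) (μ ν : Measure α) : ℝ≥0∞ :=
  ⨆ (g : α → ℝ) (_ : Measurable g) (_ : ∃ c : ℝ, ∀ x, |g x| ≤ c)
    (_ : ∀ x, ENNReal.ofReal |g x| ≤ V x), ENNReal.ofReal |∫ x, g x ∂μ - ∫ x, g x ∂ν|

/-- The transition kernel `K` is `V`-uniformly ergodic with limit `π`:
`‖Kⁿ(y, ·) - π‖_V ≤ R V(y) ρⁿ` for all `n` and `y`, with `V ≥ 1`, `R < ∞` and `0 < ρ < 1`. -/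
def IsVUniformlyErgodic {α : Type*} [MeasurableSpace α] (K : Kernel α α) (π : Measure α)
    (V : α → ℝ≥0∞) : Prop :=
  Measurable V ∧ (∀ x, 1 ≤ V x) ∧
    ∃ (R : ℝ≥0) (ρ : ℝ), 0 < ρ ∧ ρ < 1 ∧
      ∀ (n : ℕ) (y : α), vDist V ((K ^ n) y) π ≤ R * V y * ENNReal.ofReal ρ ^ n

/-- `V₊(s) = sup { k₀(x, x)^{1/2} V(x) : k₀(x, x) ≤ s² }`. -/
def vPlus {α : Type*} (k₀ : α → α → ℝ) (V : α → ℝ≥0∞) (s : ℝ) : ℝ≥0∞ :=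
  ⨆ (x : α) (_ : k₀ x x ≤ s ^ 2), ENNReal.ofReal (Real.sqrt (k₀ x x)) * V x

/-- `V₋(s) = sup { k₀(x, x)^{1/2} V(x)⁻¹ : k₀(x, x) ≤ s² }`. -/
def vMinus {α : Type*} (k₀ : α → α → ℝ) (V : α → ℝ≥0∞) (s : ℝ) : ℝ≥0∞ :=
  ⨆ (x : α) (_ : k₀ x x ≤ s ^ 2), ENNReal.ofReal (Real.sqrt (k₀ x x)) * (V x)⁻¹

/-- The truncation radius `S = √((2 / γ) log (n ∧ m))` for `m` candidates and `n` steps. -/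
def searchRadius (γ : ℝ) (n m : ℕ) : ℝ :=
  Real.sqrt (2 / γ * Real.log (min n m : ℕ))

end KSDThinning

end

open KSDThinning

/-! The Stein kernel is a Gram kernel, `k₀ x y = ⟪ξ x, ξ y⟫`, so the squared KSD of `D` is `‖F‖² /
|D|²` with `F = ∑ ξ x` over `D`. Since `|D_n| ≥ c f(n)`, it suffices to bound the expectation of
`‖F_n‖²` by a constant times `n log n`.

Two averaging arguments give a pathwise bound. Removing a least influential point does at least as
well as removing a uniformly random one; hence thinning never raises `‖F‖²` above the maximum of its
old value and the energy `∑ ‖ξ x‖²`, which itself only shrinks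
(`IsLeastInfluentialRemoval.norm_featureSum_sq_le`, `ThinLoop.le_and_le`). A greedy point does at
least as well as a random candidate, so `‖F‖²` grows by at most `a + 2 b ‖F‖`, where `a` bounds the
candidates' squared feature norms and `b` is the norm of their mean feature
(`IsGreedyPoint.norm_featureSum_sq_le`). Induction over the steps yields `‖F_n‖² ≤ 4 (A + ∑ a_i) + 2
(∑ b_i)²` with `A` depending on `D₀` only (`IsOnlineKSDT.norm_featureSum_sq_le`).

In expectation, `a_i` is of order `log n` by the exponential moments, and `(∑ b_i)² ≤ n ∑ b_i²` by
Cauchy–Schwarz, so no independence between different steps is needed. The expectation of `b_i²` is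
the average of all `k₀ (Z l) (Z r)` along the chain. By the Stein identity `k₀ x` has mean zero
under the target (`integral_steinKernelOn`), so ergodicity makes these covariances decay
geometrically, after truncation of `k₀` at level `(4 / γ) log n`, up to errors of order `1 / n`
(`IsMarkovChain.integral_kernel_le`). Thus the expectation of `b_i²` is `O((1 + √log n) / n)`, and
the total is `O(n log n)`. This already gives the first summand of the claimed bound; the second is
nonnegative. -/

open Filter Topology

/-! ### Hilbert space feature maps of positive semidefinite kernels -/

/-- A symmetric positive semidefinite real kernel has a Hilbert space feature map. -/
theorem exists_featureMap.{u} {α : Type u} (k : α → α → ℝ) (hsymm : ∀ x y, k x y = k y x)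
    (hnonneg : ∀ v : α →₀ ℝ, 0 ≤ v.sum fun x a => v.sum fun y b => a * b * k x y) :
    ∃ (H : Type u) (_ : NormedAddCommGroup H) (_ : InnerProductSpace ℝ H) (_ : CompleteSpace H)
      (φ : α → H), ∀ x y, inner ℝ (φ x) (φ y) = k x y := by
  -- The RKHS construction takes operator-valued kernels, so the scalar `k x y` acts on `ℝ` by
  -- multiplication.
  let K : Matrix α α (ℝ →L[ℝ] ℝ) := .of fun x y => k x y • 1
  have hK : K.PosSemidef := by
    have hh : K.IsHermitian := by
      ext x y
      simp [K, hsymm x y]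
    have h2 : ∀ (vv : α →₀ ℝ),
      0 ≤ RCLike.re (vv.sum fun x w ↦ vv.sum fun x' w' ↦ (inner ℝ (K x' x w) w' : ℝ)) := by
      intro v
      convert hnonneg v using 1
      simp only [Finsupp.sum, RCLike.re_to_real]
      refine Finset.sum_congr rfl fun x _ => Finset.sum_congr rfl fun y _ => ?_
      simp [K, hsymm x]
      ring
    have h3 := (RKHS.posSemidef_tfae (K := K)).out 0 2
    exact h3.mpr ⟨hh, h2⟩
  have : Fact K.PosSemidef := ⟨hK⟩
  refine ⟨RKHS.OfKernel K, inferInstance, inferInstance, inferInstance,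
    fun x => RKHS.kerFun (RKHS.OfKernel K) x 1, fun x y => ?_⟩
  rw [← RKHS.kernel_inner, RKHS.OfKernel.kernel_ofKernel]
  simp [K, hsymm x]

/-- The Hilbert space feature map of a kernel that is positive semidefinite on a subset. -/
theorem KSDThinning.IsBaseKernel.exists_featureMap {d : ℕ} {X : Set (EuclideanSpace ℝ (Fin d))}
    {k : EuclideanSpace ℝ (Fin d) → EuclideanSpace ℝ (Fin d) → ℝ} (hk : IsBaseKernel X k) :
    ∃ (H : Type) (_ : NormedAddCommGroup H) (_ : InnerProductSpace ℝ H) (_ : CompleteSpace H)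
      (φ : EuclideanSpace ℝ (Fin d) → H),
      ∀ x ∈ X, ∀ y ∈ X, inner ℝ (φ x) (φ y) = k x y := by
  classical
  obtain ⟨H, i1, i2, i3, φ, hφ⟩ := _root_.exists_featureMap (fun x y : X => k x y)
    (fun x y => hk.symm x x.2 y y.2) (fun v => by
      have h := hk.nonneg (v.support.map (Function.Embedding.subtype _))
        (by intro x hx; simp at hx; exact hx.1)
        (fun x => if h : x ∈ X then v ⟨x, h⟩ else 0)
      simpa [Finsupp.sum] using h)
  refine ⟨H, i1, i2, i3, fun x => if h : x ∈ X then φ ⟨x, h⟩ else 0, fun x hx y hy => ?_⟩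
  simp [hx, hy, hφ]

/-! ### Mixed second derivatives and mixed difference quotients -/

section MixedDerivative

variable {E : Type*} [NormedAddCommGroup E] [NormedSpace ℝ E]

/-- The mixed second directional derivative of `k`, the first in the first and the second in the
second argument. -/
noncomputable def mixedDeriv (k : E → E → ℝ) (x y e e' : E) : ℝ :=
  fderiv ℝ (fderiv ℝ (Function.uncurry k)) (x, y) (e, 0) (0, e')

variable {X : Set E} {k : E → E → ℝ}

theorem prod_mem_nhds_of_isOpen {E : Type*} [TopologicalSpace E] {X : Set E} (hX : IsOpen X)
    {x y : E} (hx : x ∈ X) (hy : y ∈ X) :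
    X ×ˢ X ∈ 𝓝 (x, y) := (hX.prod hX).mem_nhds ⟨hx, hy⟩

theorem hasFDerivAt_uncurry (hX : IsOpen X) (hk : ContDiffOn ℝ 2 (Function.uncurry k) (X ×ˢ X))
    {x y : E} (hx : x ∈ X) (hy : y ∈ X) :
    HasFDerivAt (Function.uncurry k) (fderiv ℝ (Function.uncurry k) (x, y)) (x, y) :=
  ((hk.contDiffAt (prod_mem_nhds_of_isOpen hX hx hy)).differentiableAt (by simp)).hasFDerivAt

theorem contDiffOn_fderiv_uncurry (hX : IsOpen X)
    (hk : ContDiffOn ℝ 2 (Function.uncurry k) (X ×ˢ X)) :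
    ContDiffOn ℝ 1 (fderiv ℝ (Function.uncurry k)) (X ×ˢ X) :=
  hk.fderiv_of_isOpen (hX.prod hX) (by norm_num)

theorem hasFDerivAt_fderiv_uncurry (hX : IsOpen X)
    (hk : ContDiffOn ℝ 2 (Function.uncurry k) (X ×ˢ X)) {x y : E} (hx : x ∈ X) (hy : y ∈ X) :
    HasFDerivAt (fderiv ℝ (Function.uncurry k))
      (fderiv ℝ (fderiv ℝ (Function.uncurry k)) (x, y)) (x, y) :=
  (((contDiffOn_fderiv_uncurry hX hk).contDiffAt
    (prod_mem_nhds_of_isOpen hX hx hy)).differentiableAt (by simp)).hasFDerivAt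

theorem continuousOn_mixedDeriv (hX : IsOpen X)
    (hk : ContDiffOn ℝ 2 (Function.uncurry k) (X ×ˢ X)) (e e' : E) :
    ContinuousOn (fun z : E × E => mixedDeriv k z.1 z.2 e e') (X ×ˢ X) := by
  have h : ContinuousOn (fderiv ℝ (fderiv ℝ (Function.uncurry k))) (X ×ˢ X) :=
    (contDiffOn_fderiv_uncurry hX hk).continuousOn_fderiv_of_isOpen (hX.prod hX) (by norm_num)
  exact (h.clm_apply continuousOn_const).clm_apply continuousOn_const

theorem hasFDerivAt_left (hX : IsOpen X) (hk : ContDiffOn ℝ 2 (Function.uncurry k) (X ×ˢ X))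
    {x y : E} (hx : x ∈ X) (hy : y ∈ X) :
    HasFDerivAt (fun x' => k x' y)
      ((fderiv ℝ (Function.uncurry k) (x, y)).comp (ContinuousLinearMap.inl ℝ E E)) x :=
  HasFDerivAt.comp (g := Function.uncurry k) (f := fun x' => (x', y)) x
    (hasFDerivAt_uncurry hX hk hx hy) (hasFDerivAt_prodMk_left (𝕜 := ℝ) x y)

theorem hasFDerivAt_right (hX : IsOpen X) (hk : ContDiffOn ℝ 2 (Function.uncurry k) (X ×ˢ X))
    {x y : E} (hx : x ∈ X) (hy : y ∈ X) :
    HasFDerivAt (fun y' => k x y')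
      ((fderiv ℝ (Function.uncurry k) (x, y)).comp (ContinuousLinearMap.inr ℝ E E)) y :=
  HasFDerivAt.comp (g := Function.uncurry k) (f := fun y' => (x, y')) y
    (hasFDerivAt_uncurry hX hk hx hy) (hasFDerivAt_prodMk_right (𝕜 := ℝ) x y)

/-- Connects the iterated derivative in `steinKernel` with the jointly continuous second derivative
of the uncurried kernel. -/
theorem fderiv_fderiv_eq_mixedDeriv (hX : IsOpen X)
    (hk : ContDiffOn ℝ 2 (Function.uncurry k) (X ×ˢ X)) {x y : E} (hx : x ∈ X) (hy : y ∈ X)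
    (e e' : E) :
    fderiv ℝ (fun x' => fderiv ℝ (fun y' => k x' y') y e') x e = mixedDeriv k x y e e' := by
  have h : (fun x' => fderiv ℝ (fun y' => k x' y') y e') =ᶠ[𝓝 x]
      fun x' => fderiv ℝ (Function.uncurry k) (x', y) (0, e') := by
    filter_upwards [hX.mem_nhds hx] with x' hx'
    rw [(hasFDerivAt_right hX hk hx' hy).fderiv]
    simp
  rw [h.fderiv_eq]
  have h2 : HasFDerivAt (fun x' => fderiv ℝ (Function.uncurry k) (x', y)) _ x :=
    HasFDerivAt.comp (g := fderiv ℝ (Function.uncurry k)) (f := fun x' => (x', y)) x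
      (hasFDerivAt_fderiv_uncurry hX hk hx hy) (hasFDerivAt_prodMk_left (𝕜 := ℝ) x y)
  rw [(h2.clm_apply (hasFDerivAt_const ((0, e') : E × E) x)).fderiv]
  simp [mixedDeriv]

theorem hasDerivAt_fderiv_uncurry_left (hX : IsOpen X)
    (hk : ContDiffOn ℝ 2 (Function.uncurry k) (X ×ˢ X)) {x y e : E} {s : ℝ} (hx : x + s • e ∈ X)
    (hy : y ∈ X) (e' : E) :
    HasDerivAt (fun s : ℝ => fderiv ℝ (Function.uncurry k) (x + s • e, y) (0, e'))
      (mixedDeriv k (x + s • e) y e e') s := by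
  have hl : HasDerivAt (fun s : ℝ => (x + s • e, y)) (e, 0) s := by
    refine HasDerivAt.prodMk ?_ (hasDerivAt_const _ _)
    simpa using ((hasDerivAt_id s).smul_const e).const_add x
  have h2 : HasDerivAt (fun s : ℝ => fderiv ℝ (Function.uncurry k) (x + s • e, y))
      (fderiv ℝ (fderiv ℝ (Function.uncurry k)) (x + s • e, y) (e, 0)) s :=
    HasFDerivAt.comp_hasDerivAt (l := fderiv ℝ (Function.uncurry k))
      (f := fun s : ℝ => (x + s • e, y)) s (hasFDerivAt_fderiv_uncurry hX hk hx hy) hl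
  refine (h2.clm_apply (hasDerivAt_const s ((0, e') : E × E))).congr_deriv ?_
  simp [mixedDeriv]

theorem hasDerivAt_right (hX : IsOpen X)
    (hk : ContDiffOn ℝ 2 (Function.uncurry k) (X ×ˢ X)) {x y e : E} {t : ℝ} (hx : x ∈ X)
    (hy : y + t • e ∈ X) :
    HasDerivAt (fun t : ℝ => k x (y + t • e))
      (fderiv ℝ (Function.uncurry k) (x, y + t • e) (0, e)) t := by
  have hl : HasDerivAt (fun t : ℝ => y + t • e) e t := by
    simpa using ((hasDerivAt_id t).smul_const e).const_add y
  refine (HasFDerivAt.comp_hasDerivAt (l := fun y' => k x y')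
      (f := fun t : ℝ => y + t • e) t (hasFDerivAt_right hX hk hx hy) hl).congr_deriv ?_
  simp

theorem hasDerivAt_left (hX : IsOpen X)
    (hk : ContDiffOn ℝ 2 (Function.uncurry k) (X ×ˢ X)) {x y e : E} {t : ℝ} (hx : x + t • e ∈ X)
    (hy : y ∈ X) :
    HasDerivAt (fun t : ℝ => k (x + t • e) y)
      (fderiv ℝ (Function.uncurry k) (x + t • e, y) (e, 0)) t := by
  have hl : HasDerivAt (fun t : ℝ => x + t • e) e t := by
    simpa using ((hasDerivAt_id t).smul_const e).const_add x
  refine (HasFDerivAt.comp_hasDerivAt (l := fun x' => k x' y)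
      (f := fun t : ℝ => x + t • e) t (hasFDerivAt_left hX hk hx hy) hl).congr_deriv ?_
  simp

/-- The mixed difference quotient of a `C²` function tends to the mixed derivative. -/
theorem tendsto_mixed_difference_quotient (hX : IsOpen X)
    (hk : ContDiffOn ℝ 2 (Function.uncurry k) (X ×ˢ X)) {x y : E} (hx : x ∈ X) (hy : y ∈ X)
    (e e' : E) :
    Tendsto (fun q : ℝ × ℝ => q.1⁻¹ * q.2⁻¹ *
        (k (x + q.1 • e) (y + q.2 • e') - k (x + q.1 • e) y - k x (y + q.2 • e') + k x y))
      (𝓝[≠] 0 ×ˢ 𝓝[≠] 0) (𝓝 (mixedDeriv k x y e e')) := by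
  set D := mixedDeriv k x y e e' with hD
  rw [Metric.tendsto_nhds]
  intro ε hε
  have hcont : ContinuousAt (fun q : ℝ × ℝ => (x + q.1 • e, y + q.2 • e')) 0 := by fun_prop
  have hmem : ∀ᶠ q : ℝ × ℝ in 𝓝 0, (x + q.1 • e ∈ X ∧ y + q.2 • e' ∈ X) ∧
      |mixedDeriv k (x + q.1 • e) (y + q.2 • e') e e' - D| < ε / 2 := by
    have h1 : ContinuousAt (fun z : E × E => mixedDeriv k z.1 z.2 e e') (x, y) :=
      (continuousOn_mixedDeriv hX hk e e').continuousAt (prod_mem_nhds_of_isOpen hX hx hy)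
    have hc : Tendsto (fun q : ℝ × ℝ => (x + q.1 • e, y + q.2 • e')) (𝓝 0) (𝓝 (x, y)) := by
      simpa [ContinuousAt] using hcont
    refine (hc.eventually (prod_mem_nhds_of_isOpen hX hx hy)).and ?_
    exact (h1.tendsto.comp hc).eventually (Metric.ball_mem_nhds _ (half_pos hε))
  obtain ⟨δ, hδ, hball⟩ := Metric.eventually_nhds_iff_ball.mp hmem
  have hball' : ∀ s ∈ Metric.ball (0 : ℝ) δ, ∀ t ∈ Metric.ball (0 : ℝ) δ,
      (x + s • e ∈ X ∧ y + t • e' ∈ X) ∧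
      |mixedDeriv k (x + s • e) (y + t • e') e e' - D| < ε / 2 := by
    intro s hs t ht
    refine hball (s, t) ?_
    rw [Prod.zero_eq_mk, ← ball_prod_same]
    exact ⟨hs, ht⟩
  have h0 : (0 : ℝ) ∈ Metric.ball (0 : ℝ) δ := Metric.mem_ball_self hδ
  let A : ℝ → ℝ → ℝ := fun s t =>
    fderiv ℝ (Function.uncurry k) (x + s • e, y + t • e') (0, e')
  -- Mean value inequality in `s`, applied to `A s t - s * D`, whose derivative is at most `ε / 2`
  -- on the ball.
  have hA : ∀ s ∈ Metric.ball (0 : ℝ) δ, ∀ t ∈ Metric.ball (0 : ℝ) δ,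
      |A s t - A 0 t - s * D| ≤ ε / 2 * |s| := by
    intro s hs t ht
    have key := (convex_ball (0 : ℝ) δ).norm_image_sub_le_of_norm_hasDerivWithin_le
      (f := fun s => A s t - s * D)
      (f' := fun s => mixedDeriv k (x + s • e) (y + t • e') e e' - D) (C := ε / 2)
      (fun s hs => by
        obtain ⟨⟨h1, h2⟩, -⟩ := hball' s hs t ht
        refine (((hasDerivAt_fderiv_uncurry_left hX hk h1 h2 e').sub
          ((hasDerivAt_id s).mul_const D)).congr_deriv ?_).hasDerivWithinAt
        simp)
      (fun s hs => by
        rw [Real.norm_eq_abs]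
        exact (hball' s hs t ht).2.le) h0 hs
    simpa [Real.norm_eq_abs, sub_right_comm] using key
  -- Mean value inequality in `t`; the derivative of the mixed difference minus `t * (s * D)` is the
  -- quantity bounded in `hA`.
  have hB : ∀ s ∈ Metric.ball (0 : ℝ) δ, ∀ t ∈ Metric.ball (0 : ℝ) δ,
      |k (x + s • e) (y + t • e') - k (x + s • e) y - k x (y + t • e') + k x y - s * t * D| ≤
        ε / 2 * |s| * |t| := by
    intro s hs t ht
    have key := (convex_ball (0 : ℝ) δ).norm_image_sub_le_of_norm_hasDerivWithin_le
      (f := fun t => k (x + s • e) (y + t • e') - k x (y + t • e') - t * (s * D))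
      (f' := fun t => A s t - A 0 t - s * D) (C := ε / 2 * |s|)
      (fun t ht => by
        have hd : ∀ s ∈ Metric.ball (0 : ℝ) δ,
            HasDerivAt (fun t => k (x + s • e) (y + t • e')) (A s t) t := by
          intro s hs
          obtain ⟨⟨h1, h2⟩, -⟩ := hball' s hs t ht
          exact hasDerivAt_right hX hk h1 h2
        have hd0 := hd 0 h0
        simp only [zero_smul, add_zero] at hd0
        refine ((((hd s hs).sub hd0).sub
          ((hasDerivAt_id t).mul_const (s * D))).congr_deriv ?_).hasDerivWithinAt
        simp)
      (fun t ht => by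
        rw [Real.norm_eq_abs]
        exact hA s hs t ht) h0 ht
    convert key using 1
    · rw [Real.norm_eq_abs]
      congr 1
      simp
      ring
    · simp
  have hev : ∀ᶠ q : ℝ × ℝ in 𝓝[≠] 0 ×ˢ 𝓝[≠] 0,
      (q.1 ∈ Metric.ball (0 : ℝ) δ ∧ q.1 ≠ 0) ∧ (q.2 ∈ Metric.ball (0 : ℝ) δ ∧ q.2 ≠ 0) := by
    have h1 : ∀ᶠ s : ℝ in 𝓝[≠] 0, s ∈ Metric.ball (0 : ℝ) δ ∧ s ≠ 0 :=
      Filter.Eventually.and (nhdsWithin_le_nhds (Metric.ball_mem_nhds _ hδ))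
        self_mem_nhdsWithin
    exact h1.prod_mk h1
  filter_upwards [hev] with q ⟨⟨hs, hs0⟩, ht, ht0⟩
  have hq := hB q.1 hs q.2 ht
  rw [Real.dist_eq]
  set G := k (x + q.1 • e) (y + q.2 • e') - k (x + q.1 • e) y - k x (y + q.2 • e') + k x y
  have h3 : q.1⁻¹ * q.2⁻¹ * G - D = q.1⁻¹ * q.2⁻¹ * (G - q.1 * q.2 * D) := by
    field_simp
  rw [h3, abs_mul, abs_mul, abs_inv, abs_inv]
  have hs1 : 0 < |q.1| := abs_pos.mpr hs0
  have ht1 : 0 < |q.2| := abs_pos.mpr ht0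
  calc |q.1|⁻¹ * |q.2|⁻¹ * |G - q.1 * q.2 * D| ≤ |q.1|⁻¹ * |q.2|⁻¹ * (ε / 2 * |q.1| * |q.2|) := by
        gcongr
    _ = ε / 2 := by field_simp
    _ < ε := half_lt_self hε

end MixedDerivative

/-! ### Directional derivatives of the feature map -/

section FeatureDerivative

variable {E H : Type*} [NormedAddCommGroup E] [NormedSpace ℝ E] [NormedAddCommGroup H]
  [InnerProductSpace ℝ H]

/-- The difference quotient of `φ` at `x` in direction `e`. -/
noncomputable def diffQuot (φ : E → H) (x e : E) (t : ℝ) : H := t⁻¹ • (φ (x + t • e) - φ x)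

variable {X : Set E} {k : E → E → ℝ} {φ : E → H}

theorem eventually_add_smul_mem (hX : IsOpen X) {x : E} (hx : x ∈ X) (e : E) :
    ∀ᶠ t : ℝ in 𝓝[≠] 0, x + t • e ∈ X := by
  have h : Tendsto (fun t : ℝ => x + t • e) (𝓝 0) (𝓝 x) := by
    have : ContinuousAt (fun t : ℝ => x + t • e) 0 := by fun_prop
    simpa [ContinuousAt] using this
  exact (h.mono_left nhdsWithin_le_nhds).eventually (hX.mem_nhds hx)

/-- By bilinearity this inner product is exactly the mixed difference quotient of `k`. The two
increments tend to zero independently, which is what the Cauchy argument below needs. -/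
theorem tendsto_inner_diffQuot (hX : IsOpen X)
    (hk : ContDiffOn ℝ 2 (Function.uncurry k) (X ×ˢ X))
    (hφ : ∀ x ∈ X, ∀ y ∈ X, inner ℝ (φ x) (φ y) = k x y) {x y : E} (hx : x ∈ X) (hy : y ∈ X)
    (e e' : E) :
    Tendsto (fun q : ℝ × ℝ => (inner ℝ (diffQuot φ x e q.1) (diffQuot φ y e' q.2) : ℝ))
      (𝓝[≠] 0 ×ˢ 𝓝[≠] 0) (𝓝 (mixedDeriv k x y e e')) := by
  refine (tendsto_mixed_difference_quotient hX hk hx hy e e').congr' ?_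
  filter_upwards [(eventually_add_smul_mem hX hx e).prod_mk
    (eventually_add_smul_mem hX hy e')] with q ⟨h1, h2⟩
  simp only [diffQuot, inner_smul_left, inner_smul_right, inner_sub_left, inner_sub_right,
    hφ _ h1 _ h2, hφ _ h1 _ hy, hφ _ hx _ h2, hφ _ hx _ hy]
  simp
  ring

/-- The feature map of a `C²` kernel has directional derivatives. -/
theorem exists_tendsto_diffQuot [CompleteSpace H] (hX : IsOpen X)
    (hk : ContDiffOn ℝ 2 (Function.uncurry k) (X ×ˢ X))
    (hφ : ∀ x ∈ X, ∀ y ∈ X, inner ℝ (φ x) (φ y) = k x y) {x : E} (hx : x ∈ X) (e : E) :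
    ∃ h : H, Tendsto (diffQuot φ x e) (𝓝[≠] 0) (𝓝 h) := by
  -- Expanding `‖q_s - q_t‖²` gives two squared norms and a cross term, all with limit `mixedDeriv k
  -- x x e e`, and the coefficients `1 - 2 + 1` cancel.
  have hc : Cauchy (Filter.map (diffQuot φ x e) (𝓝[≠] (0 : ℝ))) := by
    rw [cauchy_map_iff', Metric.uniformity_eq_comap_nhds_zero, tendsto_comap_iff]
    have hT := tendsto_inner_diffQuot hX hk hφ hx hx e e
    have hd : Tendsto (fun t : ℝ => (inner ℝ (diffQuot φ x e t) (diffQuot φ x e t) : ℝ))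
        (𝓝[≠] 0) (𝓝 (mixedDeriv k x x e e)) := hT.comp (tendsto_id.prodMk tendsto_id)
    have h := ((hd.comp tendsto_fst).sub (hT.const_mul 2)).add (hd.comp tendsto_snd)
    have h0 : mixedDeriv k x x e e - 2 * mixedDeriv k x x e e + mixedDeriv k x x e e = 0 := by
      ring
    rw [h0] at h
    have h2 := h.sqrt
    rw [Real.sqrt_zero] at h2
    refine h2.congr fun q => ?_
    simp only [Function.comp_apply]
    rw [dist_eq_norm, ← Real.sqrt_sq (norm_nonneg (diffQuot φ x e q.1 - diffQuot φ x e q.2)),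
      norm_sub_sq_real, real_inner_self_eq_norm_sq, real_inner_self_eq_norm_sq]
  obtain ⟨h, hh⟩ := CompleteSpace.complete hc
  exact ⟨h, hh⟩

/-- The directional derivative of `φ` at `x` in direction `e`. -/
noncomputable def dirDeriv (φ : E → H) (x e : E) : H := limUnder (𝓝[≠] (0 : ℝ)) (diffQuot φ x e)

theorem tendsto_diffQuot_dirDeriv [CompleteSpace H] (hX : IsOpen X)
    (hk : ContDiffOn ℝ 2 (Function.uncurry k) (X ×ˢ X))
    (hφ : ∀ x ∈ X, ∀ y ∈ X, inner ℝ (φ x) (φ y) = k x y) {x : E} (hx : x ∈ X) (e : E) :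
    Tendsto (diffQuot φ x e) (𝓝[≠] 0) (𝓝 (dirDeriv φ x e)) :=
  tendsto_nhds_limUnder (exists_tendsto_diffQuot hX hk hφ hx e)

theorem inner_dirDeriv_dirDeriv [CompleteSpace H] (hX : IsOpen X)
    (hk : ContDiffOn ℝ 2 (Function.uncurry k) (X ×ˢ X))
    (hφ : ∀ x ∈ X, ∀ y ∈ X, inner ℝ (φ x) (φ y) = k x y) {x y : E} (hx : x ∈ X) (hy : y ∈ X)
    (e e' : E) : inner ℝ (dirDeriv φ x e) (dirDeriv φ y e') = mixedDeriv k x y e e' :=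
  tendsto_nhds_unique
    (((tendsto_diffQuot_dirDeriv hX hk hφ hx e).comp tendsto_fst).inner
      ((tendsto_diffQuot_dirDeriv hX hk hφ hy e').comp tendsto_snd))
    (tendsto_inner_diffQuot hX hk hφ hx hy e e')

theorem inner_dirDeriv_left [CompleteSpace H] (hX : IsOpen X)
    (hk : ContDiffOn ℝ 2 (Function.uncurry k) (X ×ˢ X))
    (hφ : ∀ x ∈ X, ∀ y ∈ X, inner ℝ (φ x) (φ y) = k x y) {x y : E} (hx : x ∈ X) (hy : y ∈ X)
    (e : E) : inner ℝ (dirDeriv φ x e) (φ y) = fderiv ℝ (fun x' => k x' y) x e := by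
  have h1 : HasDerivAt (fun t : ℝ => k (x + t • e) y)
      (fderiv ℝ (Function.uncurry k) (x, y) (e, 0)) 0 := by
    simpa using hasDerivAt_left (t := 0) (e := e) hX hk (x := x) (by simpa using hx) hy
  have h2 : fderiv ℝ (fun x' => k x' y) x e = fderiv ℝ (Function.uncurry k) (x, y) (e, 0) := by
    rw [(hasFDerivAt_left hX hk hx hy).fderiv]
    simp
  rw [h2]
  refine tendsto_nhds_unique
    ((tendsto_diffQuot_dirDeriv hX hk hφ hx e).inner tendsto_const_nhds) ?_
  refine (hasDerivAt_iff_tendsto_slope_zero.mp h1).congr' ?_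
  filter_upwards [eventually_add_smul_mem hX hx e] with t ht
  simp [diffQuot, inner_smul_left, inner_sub_left, hφ _ ht _ hy, hφ _ hx _ hy]

end FeatureDerivative

/-! ### The feature map of the Stein kernel -/

section SteinFeature

variable {d : ℕ} {H : Type*} [NormedAddCommGroup H] [InnerProductSpace ℝ H]

/-- The `i`-th component of the feature map of the Stein kernel. -/
noncomputable def steinFeature (p : EuclideanSpace ℝ (Fin d) → ℝ)
    (φ : EuclideanSpace ℝ (Fin d) → H) (x : EuclideanSpace ℝ (Fin d)) (i : Fin d) : H :=
  score p x i • φ x + dirDeriv φ x (EuclideanSpace.single i (1 : ℝ))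

variable {X : Set (EuclideanSpace ℝ (Fin d))} {p : EuclideanSpace ℝ (Fin d) → ℝ}
  {k : EuclideanSpace ℝ (Fin d) → EuclideanSpace ℝ (Fin d) → ℝ}
  {φ : EuclideanSpace ℝ (Fin d) → H}

theorem gradient_apply (f : EuclideanSpace ℝ (Fin d) → ℝ) (x : EuclideanSpace ℝ (Fin d))
    (i : Fin d) : gradient f x i = fderiv ℝ f x (EuclideanSpace.single i (1 : ℝ)) := by
  have h : inner ℝ (gradient f x) (EuclideanSpace.single i (1 : ℝ)) =
      fderiv ℝ f x (EuclideanSpace.single i (1 : ℝ)) := by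
    simp [gradient]
  rw [← h, EuclideanSpace.inner_single_right]
  simp

theorem inner_steinFeature_left [CompleteSpace H] (hX : IsOpen X) (hk : IsBaseKernel X k)
    (hφ : ∀ x ∈ X, ∀ y ∈ X, inner ℝ (φ x) (φ y) = k x y)
    {x y : EuclideanSpace ℝ (Fin d)} (hx : x ∈ X) (hy : y ∈ X) (i : Fin d) :
    inner ℝ (steinFeature p φ x i) (φ y) = score p x i * k x y +
      gradient (fun x' => k x' y) x i := by
  rw [steinFeature, inner_add_left, inner_smul_left, hφ x hx y hy,
    inner_dirDeriv_left hX hk.contDiffOn hφ hx hy, gradient_apply]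
  simp

theorem inner_steinFeature [CompleteSpace H] (hX : IsOpen X) (hk : IsBaseKernel X k)
    (hφ : ∀ x ∈ X, ∀ y ∈ X, inner ℝ (φ x) (φ y) = k x y)
    {x y : EuclideanSpace ℝ (Fin d)} (hx : x ∈ X) (hy : y ∈ X) (i : Fin d) :
    inner ℝ (steinFeature p φ x i) (steinFeature p φ y i) =
      score p x i * score p y i * k x y + score p y i * gradient (fun x' => k x' y) x i
        + score p x i * gradient (fun y' => k x y') y i
        + mixedDeriv k x y (EuclideanSpace.single i (1 : ℝ)) (EuclideanSpace.single i (1 : ℝ)) := by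
  have hsymm : fderiv ℝ (fun x' => k x' x) y = fderiv ℝ (fun y' => k x y') y := by
    refine Filter.EventuallyEq.fderiv_eq ?_
    filter_upwards [hX.mem_nhds hy] with z hz using hk.symm z hz x hx
  have h1 : inner ℝ (φ x) (dirDeriv φ y (EuclideanSpace.single i (1 : ℝ))) =
      fderiv ℝ (fun y' => k x y') y (EuclideanSpace.single i (1 : ℝ)) := by
    rw [real_inner_comm, inner_dirDeriv_left hX hk.contDiffOn hφ hy hx, hsymm]
  rw [gradient_apply, gradient_apply, steinFeature, steinFeature, inner_add_left, inner_add_right,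
    inner_add_right, inner_smul_left, inner_smul_right, inner_smul_left, inner_smul_right,
    hφ x hx y hy, h1, inner_dirDeriv_left hX hk.contDiffOn hφ hx hy,
    inner_dirDeriv_dirDeriv hX hk.contDiffOn hφ hx hy]
  simp
  ring

/-- The Stein kernel arises from `k` by applying `score i + ∂ᵢ` in both arguments and summing over
`i`; on the feature side each application turns `φ` into `steinFeature`. -/
theorem steinKernel_eq_sum_inner [CompleteSpace H] (hX : IsOpen X) (hk : IsBaseKernel X k)
    (hφ : ∀ x ∈ X, ∀ y ∈ X, inner ℝ (φ x) (φ y) = k x y)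
    {x y : EuclideanSpace ℝ (Fin d)} (hx : x ∈ X) (hy : y ∈ X) :
    steinKernel p k x y =
      ∑ i, inner ℝ (steinFeature p φ x i) (steinFeature p φ y i) := by
  simp only [inner_steinFeature hX hk hφ hx hy, Finset.sum_add_distrib, steinKernel,
    fderiv_fderiv_eq_mixedDeriv hX hk.contDiffOn hx hy]
  simp only [PiLp.inner_apply, Finset.sum_mul]
  simp [mul_comm]

end SteinFeature

theorem Measurable.of_eq {α β : Type*} [MeasurableSpace α] [MeasurableSpace β] {f g : α → β}
    (hf : Measurable f) (h : ∀ x, f x = g x) : Measurable g :=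
  (funext h : f = g) ▸ hf

/-! ### Measurability and the Stein identity -/

section Target

variable {d : ℕ} {X : Set (EuclideanSpace ℝ (Fin d))} {p : EuclideanSpace ℝ (Fin d) → ℝ}
  {k : EuclideanSpace ℝ (Fin d) → EuclideanSpace ℝ (Fin d) → ℝ}

theorem KSDThinning.IsTargetDensity.measurable (hp : IsTargetDensity X p) :
    Measurable fun x : X => p x :=
  (continuousOn_iff_continuous_domRestrict.mp hp.differentiableOn.continuousOn).measurable

theorem KSDThinning.IsTargetDensity.isProbabilityMeasure (hp : IsTargetDensity X p) :
    IsProbabilityMeasure (targetMeasure X p) := by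
  refine ⟨?_⟩
  rw [targetMeasure, withDensity_apply _ MeasurableSet.univ, Measure.restrict_univ,
    lintegral_subtype_comap hp.isOpen.measurableSet (fun x => ENNReal.ofReal (p x)),
    hp.lintegral_eq_one]

theorem integral_targetMeasure (hp : IsTargetDensity X p) (g : EuclideanSpace ℝ (Fin d) → ℝ) :
    ∫ x : X, g x ∂(targetMeasure X p) = ∫ x in X, p x * g x := by
  rw [targetMeasure, integral_withDensity_eq_integral_toReal_smul
    hp.measurable.ennreal_ofReal (by simp),
    ← integral_subtype_comap hp.isOpen.measurableSet (fun x => p x * g x)]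
  refine integral_congr_ae (Eventually.of_forall fun x => ?_)
  simp [ENNReal.toReal_ofReal (hp.pos x x.2).le]

theorem measurable_score (i : Fin d) : Measurable fun x => score p x i := by
  simp only [score, gradient_apply]
  exact measurable_fderiv_apply_const ℝ _ _

theorem continuous_subtype_prod {F : Type*} [TopologicalSpace F]
    {g : EuclideanSpace ℝ (Fin d) × EuclideanSpace ℝ (Fin d) → F} (hg : ContinuousOn g (X ×ˢ X)) :
    Continuous fun z : X × X => g (z.1, z.2) :=
  hg.comp_continuous (by fun_prop) fun z => ⟨z.1.2, z.2.2⟩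

theorem KSDThinning.IsBaseKernel.continuous (hk : IsBaseKernel X k) :
    Continuous fun z : X × X => k z.1 z.2 :=
  continuous_subtype_prod (g := Function.uncurry k) hk.contDiffOn.continuousOn

theorem continuousOn_fderiv_uncurry_apply (hX : IsOpen X) (hk : IsBaseKernel X k)
    (e : EuclideanSpace ℝ (Fin d) × EuclideanSpace ℝ (Fin d)) :
    Continuous fun z : X × X => fderiv ℝ (Function.uncurry k) (z.1, z.2) e :=
  continuous_subtype_prod (g := fun z => fderiv ℝ (Function.uncurry k) z e)
    ((contDiffOn_fderiv_uncurry hX hk.contDiffOn).continuousOn.clm_apply continuousOn_const)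

theorem continuous_gradient_left (hX : IsOpen X) (hk : IsBaseKernel X k) (i : Fin d) :
    Continuous fun z : X × X => gradient (fun x' => k x' z.2) (z.1 : EuclideanSpace ℝ (Fin d)) i := by
  refine (continuousOn_fderiv_uncurry_apply hX hk (EuclideanSpace.single i (1 : ℝ), 0)).congr
    fun z => ?_
  rw [gradient_apply, (hasFDerivAt_left hX hk.contDiffOn z.1.2 z.2.2).fderiv]
  simp

theorem continuous_gradient_right (hX : IsOpen X) (hk : IsBaseKernel X k) (i : Fin d) :
    Continuous fun z : X × X =>
      gradient (fun y' => k z.1 y') (z.2 : EuclideanSpace ℝ (Fin d)) i := by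
  refine (continuousOn_fderiv_uncurry_apply hX hk (0, EuclideanSpace.single i (1 : ℝ))).congr
    fun z => ?_
  rw [gradient_apply, (hasFDerivAt_right hX hk.contDiffOn z.1.2 z.2.2).fderiv]
  simp

variable {H : Type*} [NormedAddCommGroup H] [InnerProductSpace ℝ H] [CompleteSpace H]
  {φ : EuclideanSpace ℝ (Fin d) → H}

/-- `H` need not be separable, so measurability is established for scalar inner products, through
their explicit formula, and never for the feature map itself. -/
theorem measurable_inner_steinFeature (hX : IsOpen X) (hk : IsBaseKernel X k)
    (hφ : ∀ x ∈ X, ∀ y ∈ X, inner ℝ (φ x) (φ y) = k x y) (i : Fin d) :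
    Measurable fun z : X × X => (inner ℝ (steinFeature p φ z.1 i) (steinFeature p φ z.2 i) : ℝ) := by
  have hs1 : Measurable fun z : X × X => score p (z.1 : EuclideanSpace ℝ (Fin d)) i :=
    (measurable_score i).comp (measurable_subtype_coe.comp measurable_fst)
  have hs2 : Measurable fun z : X × X => score p (z.2 : EuclideanSpace ℝ (Fin d)) i :=
    (measurable_score i).comp (measurable_subtype_coe.comp measurable_snd)
  have hm : Measurable fun z : X × X => mixedDeriv k z.1 z.2
      (EuclideanSpace.single i (1 : ℝ)) (EuclideanSpace.single i (1 : ℝ)) :=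
    (continuous_subtype_prod (continuousOn_mixedDeriv hX hk.contDiffOn
      (EuclideanSpace.single i (1 : ℝ)) (EuclideanSpace.single i (1 : ℝ)))).measurable
  refine Measurable.of_eq ((((hs1.mul hs2).mul hk.continuous.measurable).add
    (hs2.mul (continuous_gradient_left hX hk i).measurable)).add
    (hs1.mul (continuous_gradient_right hX hk i).measurable) |>.add hm) fun z => ?_
  exact (inner_steinFeature hX hk hφ z.1.2 z.2.2 i).symm

theorem measurable_inner_steinFeature_left (hX : IsOpen X) (hk : IsBaseKernel X k)
    (hφ : ∀ x ∈ X, ∀ y ∈ X, inner ℝ (φ x) (φ y) = k x y) (i : Fin d)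
    {y : EuclideanSpace ℝ (Fin d)} (hy : y ∈ X) :
    Measurable fun x : X => (inner ℝ (steinFeature p φ x i) (φ y) : ℝ) := by
  have hc : Continuous fun x : X => (x, (⟨y, hy⟩ : X)) := by fun_prop
  refine Measurable.of_eq ((((measurable_score (p := p) i).comp measurable_subtype_coe).mul
    (hk.continuous.comp hc).measurable).add
    ((continuous_gradient_left hX hk i).comp hc).measurable) fun x => ?_
  exact (inner_steinFeature_left hX hk hφ x.2 hy i).symm

theorem KSDThinning.IsBaseKernel.measurable_steinKernelOn (hX : IsOpen X) (hk : IsBaseKernel X k) :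
    Measurable fun z : X × X => steinKernelOn X p k z.1 z.2 := by
  obtain ⟨H, _, _, _, φ, hφ⟩ := hk.exists_featureMap
  refine Measurable.of_eq (Finset.measurable_sum Finset.univ fun i _ =>
    measurable_inner_steinFeature (p := p) hX hk hφ i) fun z => ?_
  exact (steinKernel_eq_sum_inner hX hk hφ z.1.2 z.2.2).symm

theorem exists_steinKernelOn_featureMap (hX : IsOpen X) (hk : IsBaseKernel X k) :
    ∃ (H : Type) (_ : NormedAddCommGroup H) (_ : InnerProductSpace ℝ H) (ξ : X → H),
      ∀ x y, inner ℝ (ξ x) (ξ y) = steinKernelOn X p k x y := by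
  obtain ⟨H, _, _, _, φ, hφ⟩ := hk.exists_featureMap
  refine ⟨PiLp 2 fun _ : Fin d => H, inferInstance, inferInstance,
    fun x => WithLp.toLp 2 fun i => steinFeature p φ x i, fun x y => ?_⟩
  rw [PiLp.inner_apply]
  exact (steinKernel_eq_sum_inner hX hk hφ x.2 y.2).symm

/-- The Stein identity for the components of the Stein feature, tested against `φ y`. -/
theorem integral_inner_steinFeature_left (hp : IsTargetDensity X p) (hk : IsBaseKernel X k)
    (hpk : InSteinClass X p k) (hφ : ∀ x ∈ X, ∀ y ∈ X, inner ℝ (φ x) (φ y) = k x y) (i : Fin d)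
    {y : EuclideanSpace ℝ (Fin d)} (hy : y ∈ X) :
    ∫ x : X, (inner ℝ (steinFeature p φ x i) (φ y) : ℝ) ∂(targetMeasure X p) = 0 := by
  rw [integral_targetMeasure hp fun x => (inner ℝ (steinFeature p φ x i) (φ y) : ℝ)]
  -- Since the score is `∇p / p`, multiplying by `p` turns `score * k + ∂ᵢ k` into `∂ᵢ (p k)`, whose
  -- integral the Stein class makes zero.
  have h1 : ∀ x ∈ X, p x * (inner ℝ (steinFeature p φ x i) (φ y) : ℝ) =
      (EuclideanSpace.proj i : EuclideanSpace ℝ (Fin d) →L[ℝ] ℝ)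
        (gradient (fun z => p z * k z y) x) := by
    intro x hx
    have hd : DifferentiableAt ℝ p x := hp.differentiableOn.differentiableAt (hp.isOpen.mem_nhds hx)
    have hp0 : p x ≠ 0 := (hp.pos x hx).ne'
    have hl := hasFDerivAt_left hp.isOpen hk.contDiffOn hx hy
    rw [inner_steinFeature_left hp.isOpen hk hφ hx hy]
    simp only [PiLp.proj_apply, gradient_apply, score]
    have hm : HasFDerivAt (fun z => p z * k z y) _ x := hd.hasFDerivAt.mul hl
    rw [hm.fderiv, (hd.hasFDerivAt.log hp0).fderiv, hl.fderiv]
    simp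
    field_simp
    ring
  rw [setIntegral_congr_fun hp.isOpen.measurableSet h1,
    ContinuousLinearMap.integral_comp_comm _ (hpk y hy).1, (hpk y hy).2, map_zero]

/-- The Stein identity for the components of the Stein feature. -/
theorem integral_inner_steinFeature (hp : IsTargetDensity X p) (hk : IsBaseKernel X k)
    (hpk : InSteinClass X p k) (hφ : ∀ x ∈ X, ∀ y ∈ X, inner ℝ (φ x) (φ y) = k x y) (i : Fin d)
    (hInt : Integrable (fun x : X => ‖steinFeature p φ x i‖) (targetMeasure X p))
    {y : EuclideanSpace ℝ (Fin d)} (hy : y ∈ X) :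
    ∫ x : X, (inner ℝ (steinFeature p φ x i) (steinFeature p φ y i) : ℝ) ∂(targetMeasure X p) =
      0 := by
  have hX := hp.isOpen
  set e := EuclideanSpace.single i (1 : ℝ)
  have hi : ∀ z ∈ X, Integrable (fun x : X => (inner ℝ (steinFeature p φ x i) (φ z) : ℝ))
      (targetMeasure X p) := fun z hz =>
    (hInt.mul_const ‖φ z‖).mono'
      (measurable_inner_steinFeature_left hX hk hφ i hz).aestronglyMeasurable
      (Eventually.of_forall fun x => norm_inner_le_norm _ _)
  -- `h t` is a finite combination of values of `φ`, for which the integral is zero by the previous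
  -- lemma, and it tends to `steinFeature p φ y i`. Dominated convergence then replaces
  -- differentiation under the integral.
  let h : ℝ → H := fun t => score p y i • φ y + diffQuot φ y e t
  have hh : Tendsto h (𝓝[≠] 0) (𝓝 (steinFeature p φ y i)) :=
    tendsto_const_nhds.add (tendsto_diffQuot_dirDeriv hX hk.contDiffOn hφ hy e)
  have hexp : ∀ t (x : X), (inner ℝ (steinFeature p φ x i) (h t) : ℝ) =
      score p y i * inner ℝ (steinFeature p φ x i) (φ y) +
        t⁻¹ * (inner ℝ (steinFeature p φ x i) (φ (y + t • e)) -
          inner ℝ (steinFeature p φ x i) (φ y)) := by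
    intro t x
    simp only [h, diffQuot, inner_add_right, inner_smul_right, inner_sub_right]
  have hev := eventually_add_smul_mem hX hy e
  have hzero : ∀ᶠ t in 𝓝[≠] 0,
      ∫ x : X, (inner ℝ (steinFeature p φ x i) (h t) : ℝ) ∂(targetMeasure X p) = 0 := by
    filter_upwards [hev] with t ht
    simp only [hexp]
    have hsub : Integrable (fun x : X => (inner ℝ (steinFeature p φ x i) (φ (y + t • e)) : ℝ) -
        inner ℝ (steinFeature p φ x i) (φ y)) (targetMeasure X p) := (hi _ ht).sub (hi y hy)
    rw [integral_add ((hi y hy).const_mul _) (hsub.const_mul _),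
      integral_const_mul, integral_const_mul, integral_sub (hi _ ht) (hi y hy),
      integral_inner_steinFeature_left hp hk hpk hφ i hy,
      integral_inner_steinFeature_left hp hk hpk hφ i ht]
    simp
  have hbd : ∀ᶠ t in 𝓝[≠] 0, ‖h t‖ ≤ ‖steinFeature p φ y i‖ + 1 :=
    hh.norm.eventually (eventually_le_nhds (by linarith))
  refine tendsto_nhds_unique (tendsto_integral_filter_of_dominated_convergence
    (F := fun t (x : X) => (inner ℝ (steinFeature p φ x i) (h t) : ℝ)) (l := 𝓝[≠] 0)
    (fun x : X => ‖steinFeature p φ x i‖ * (‖steinFeature p φ y i‖ + 1)) ?_ ?_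
    (hInt.mul_const _) ?_) (tendsto_const_nhds.congr' (hzero.mono fun t ht => ht.symm))
  · filter_upwards [hev] with t ht
    simp only [hexp]
    exact (((hi y hy).const_mul _).add
      (((hi _ ht).sub (hi y hy)).const_mul _)).aestronglyMeasurable
  · filter_upwards [hbd] with t ht
    refine Eventually.of_forall fun x => (norm_inner_le_norm _ _).trans ?_
    gcongr
  · exact Eventually.of_forall fun x => tendsto_const_nhds.inner hh

/-- The Stein identity: the Stein kernel has mean zero under the target. -/
theorem integral_steinKernelOn (hp : IsTargetDensity X p) (hk : IsBaseKernel X k)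
    (hpk : InSteinClass X p k)
    (hInt : Integrable (fun x : X => steinKernelOn X p k x x) (targetMeasure X p)) (y : X) :
    ∫ x, steinKernelOn X p k y x ∂(targetMeasure X p) = 0 := by
  have := hp.isProbabilityMeasure
  have hX := hp.isOpen
  obtain ⟨H, _, _, _, φ, hφ⟩ := hk.exists_featureMap
  have hnorm : ∀ i, Measurable fun x : X => ‖steinFeature p φ (x : EuclideanSpace ℝ (Fin d)) i‖ := by
    intro i
    refine Measurable.of_eq ((measurable_inner_steinFeature (p := p) hX hk hφ i).comp
      (measurable_id.prodMk measurable_id)).sqrt fun x => ?_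
    simp
  -- Here `‖ψ i‖ ≤ ‖ψ i‖² + 1 ≤ k₀ x x + 1` for each component `ψ i` of the Stein feature.
  have hi : ∀ i, Integrable (fun x : X => ‖steinFeature p φ (x : EuclideanSpace ℝ (Fin d)) i‖)
      (targetMeasure X p) := by
    intro i
    refine (hInt.add (integrable_const 1)).mono' (hnorm i).aestronglyMeasurable
      (Eventually.of_forall fun x => ?_)
    have h1 : ‖steinFeature p φ (x : EuclideanSpace ℝ (Fin d)) i‖ ^ 2 ≤ steinKernelOn X p k x x := by
      rw [steinKernelOn, steinKernel_eq_sum_inner hX hk hφ x.2 x.2]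
      simp only [real_inner_self_eq_norm_sq]
      exact Finset.single_le_sum
        (f := fun i => ‖steinFeature p φ (x : EuclideanSpace ℝ (Fin d)) i‖ ^ 2)
        (fun j _ => sq_nonneg _) (Finset.mem_univ i)
    simp only [norm_norm, Pi.add_apply]
    nlinarith [sq_nonneg (‖steinFeature p φ (x : EuclideanSpace ℝ (Fin d)) i‖ - 1)]
  have hm : ∀ i, Integrable (fun x : X =>
      (inner ℝ (steinFeature p φ x i) (steinFeature p φ y i) : ℝ)) (targetMeasure X p) := fun i =>
    ((hi i).mul_const ‖steinFeature p φ y i‖).mono'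
      ((measurable_inner_steinFeature hX hk hφ i).comp
        (measurable_id.prodMk measurable_const)).aestronglyMeasurable
      (Eventually.of_forall fun x => norm_inner_le_norm _ _)
  have heq : ∀ x : X, steinKernelOn X p k y x =
      ∑ i, (inner ℝ (steinFeature p φ x i) (steinFeature p φ y i) : ℝ) := by
    intro x
    rw [steinKernelOn, steinKernel_eq_sum_inner hX hk hφ y.2 x.2]
    exact Finset.sum_congr rfl fun i _ => real_inner_comm _ _
  simp only [heq]
  rw [integral_finsetSum _ fun i _ => hm i]
  exact Finset.sum_eq_zero fun i _ => integral_inner_steinFeature hp hk hpk hφ i (hi i) y.2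

end Target

/-! ### Deterministic analysis of thinning and greedy selection -/

section Thinning

variable {α H : Type*} [NormedAddCommGroup H] {k₀ : α → α → ℝ} {ξ : α → H}

/-- The sum of the features of the points of a dictionary. -/
def featureSum (ξ : α → H) (D : Multiset α) : H := (D.map ξ).sum

/-- The sum of the squared feature norms of the points of a dictionary. -/
noncomputable def featureEnergy (ξ : α → H) (D : Multiset α) : ℝ := (D.map fun x => ‖ξ x‖ ^ 2).sum

@[simp]
theorem featureSum_cons (x : α) (D : Multiset α) :
    featureSum ξ (x ::ₘ D) = ξ x + featureSum ξ D := by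
  simp [featureSum]

@[simp]
theorem featureEnergy_cons (x : α) (D : Multiset α) :
    featureEnergy ξ (x ::ₘ D) = ‖ξ x‖ ^ 2 + featureEnergy ξ D := by
  simp [featureEnergy]

theorem featureEnergy_nonneg (D : Multiset α) : 0 ≤ featureEnergy ξ D := by
  refine Multiset.sum_nonneg fun a ha => ?_
  obtain ⟨x, -, rfl⟩ := Multiset.mem_map.mp ha
  positivity

variable [InnerProductSpace ℝ H]

theorem inner_featureSum (v : H) (D : Multiset α) :
    inner ℝ v (featureSum ξ D) = (D.map fun x => (inner ℝ v (ξ x) : ℝ)).sum := by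
  induction D using Multiset.induction_on with
  | empty => simp [featureSum]
  | cons x D ih => simp [inner_add_right, ih]

theorem norm_featureSum_sq (hξ : ∀ x y, inner ℝ (ξ x) (ξ y) = k₀ x y) (D : Multiset α) :
    ‖featureSum ξ D‖ ^ 2 = (D.map fun x => (D.map fun y => k₀ x y).sum).sum := by
  rw [← real_inner_self_eq_norm_sq, inner_featureSum]
  simp only [real_inner_comm, inner_featureSum, hξ]

theorem ksd_sq (hξ : ∀ x y, inner ℝ (ξ x) (ξ y) = k₀ x y) (D : Multiset α) :
    ksd k₀ D ^ 2 = ‖featureSum ξ D‖ ^ 2 / (Multiset.card D : ℝ) ^ 2 := by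
  rw [ksd, ← norm_featureSum_sq hξ, Real.sq_sqrt (by positivity)]
  ring

/-- Among dictionaries of equal size the normalization cancels, so minimizing KSD is minimizing
`‖featureSum‖`. -/
theorem norm_featureSum_sq_le_of_ksd_le (hξ : ∀ x y, inner ℝ (ξ x) (ξ y) = k₀ x y)
    {D E : Multiset α} (hcard : Multiset.card D = Multiset.card E) (hD : 0 < Multiset.card D)
    (h : ksd k₀ D ≤ ksd k₀ E) : ‖featureSum ξ D‖ ^ 2 ≤ ‖featureSum ξ E‖ ^ 2 := by
  have h2 : ksd k₀ D ^ 2 ≤ ksd k₀ E ^ 2 := pow_le_pow_left₀ (Real.sqrt_nonneg _) h 2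
  rw [ksd_sq hξ, ksd_sq hξ, ← hcard] at h2
  have hc : (0 : ℝ) < (Multiset.card D : ℝ) ^ 2 := by positivity
  exact (div_le_div_iff_of_pos_right hc).mp h2

/-- Removal of a least influential point does not enlarge the discrepancy beyond the larger of its
value before and the energy: the average over all removals does not. -/
theorem KSDThinning.IsLeastInfluentialRemoval.norm_featureSum_sq_le
    (hξ : ∀ x y, inner ℝ (ξ x) (ξ y) = k₀ x y) {D E : Multiset α} {Q : ℝ}
    (hE : IsLeastInfluentialRemoval k₀ D E) (hcard : 1 < Multiset.card D)
    (hF : ‖featureSum ξ D‖ ^ 2 ≤ Q) (hT : featureEnergy ξ D ≤ Q) :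
    ‖featureSum ξ E‖ ^ 2 ≤ Q := by
  classical
  obtain ⟨⟨x₀, hx₀⟩, hmin⟩ := hE
  have hcE : Multiset.card E + 1 = Multiset.card D := by simp [hx₀]
  have hz : ∀ z ∈ D, ‖featureSum ξ E‖ ^ 2 ≤
      ‖featureSum ξ D‖ ^ 2 - 2 * inner ℝ (featureSum ξ D) (ξ z) + ‖ξ z‖ ^ 2 := by
    intro z hzD
    obtain ⟨E', rfl⟩ := Multiset.exists_cons_of_mem hzD
    have h1 : ‖featureSum ξ E‖ ^ 2 ≤ ‖featureSum ξ E'‖ ^ 2 := by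
      refine norm_featureSum_sq_le_of_ksd_le hξ ?_ (by omega) (hmin z E' rfl)
      simp at hcE
      omega
    have h2 : featureSum ξ E' = featureSum ξ (z ::ₘ E') - ξ z := by simp
    rwa [h2, norm_sub_sq_real] at h1
  -- Summing over all points with multiplicity, the cross terms add up to `-2 ‖F‖²` and the last
  -- terms to the energy.
  have hsum := Multiset.sum_map_le_sum_map (s := D) _ _ hz
  rw [Multiset.sum_map_add, Multiset.sum_map_sub, Multiset.sum_map_mul_left,
    ← inner_featureSum, real_inner_self_eq_norm_sq] at hsum
  simp only [Multiset.map_const', Multiset.sum_replicate, nsmul_eq_mul] at hsum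
  change _ ≤ _ - _ + featureEnergy ξ D at hsum
  have hN : (2 : ℝ) ≤ Multiset.card D := by exact_mod_cast hcard
  -- The sum is at most `(N - 2) ‖F‖² + energy ≤ (N - 1) Q`; `N ≥ 2` keeps the first coefficient
  -- nonnegative.
  have h3 : (Multiset.card D : ℝ) * ‖featureSum ξ E‖ ^ 2 ≤ Multiset.card D * Q := by
    nlinarith [sq_nonneg ‖featureSum ξ D‖,
      mul_le_mul_of_nonneg_left hF (by linarith : (0 : ℝ) ≤ Multiset.card D - 2)]
  exact le_of_mul_le_mul_left h3 (by linarith)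

/-- The energy has its own threshold `q ≤ Q`, because it decreases with every removal, and the
online induction needs this sharper bound on the output. -/
theorem KSDThinning.ThinLoop.le_and_le (hξ : ∀ x y, inner ℝ (ξ x) (ξ y) = k₀ x y) {T S : ℝ}
    {D D' : Multiset α} (h : ThinLoop k₀ T S D D') {Q q : ℝ} (hqQ : q ≤ Q)
    (hF : ‖featureSum ξ D‖ ^ 2 ≤ Q) (hT : featureEnergy ξ D ≤ q) :
    ‖featureSum ξ D'‖ ^ 2 ≤ Q ∧ featureEnergy ξ D' ≤ q := by
  induction h with
  | exit D h => exact ⟨hF, hT⟩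
  | brk D E h hE hT' => exact ⟨hF, hT⟩
  | step D E D' h hE hT' hD' ih =>
    have hcard : 1 < Multiset.card D := by
      have := lt_of_le_of_lt (le_max_right S 1) h.2
      exact_mod_cast this
    refine ih (hE.norm_featureSum_sq_le hξ hcard hF (hT.trans hqQ)) ?_
    obtain ⟨x, rfl⟩ := hE.1
    rw [featureEnergy_cons] at hT
    nlinarith [sq_nonneg ‖ξ x‖]

/-- The minimum over the candidates is at most their average, and averaging turns the cross term
into the inner product with the mean feature. -/
theorem KSDThinning.IsGreedyPoint.norm_featureSum_sq_le (hξ : ∀ x y, inner ℝ (ξ x) (ξ y) = k₀ x y)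
    {D : Multiset α} {y : ℕ → α} {m : ℕ} {x : α} (hm : 0 < m) (h : IsGreedyPoint k₀ D y m x)
    {a : ℝ} (ha : ∀ l ∈ Finset.Icc 1 m, ‖ξ (y l)‖ ^ 2 ≤ a) :
    ‖featureSum ξ (x ::ₘ D)‖ ^ 2 ≤ ‖featureSum ξ D‖ ^ 2 + a +
      2 * ‖(m : ℝ)⁻¹ • ∑ l ∈ Finset.Icc 1 m, ξ (y l)‖ * ‖featureSum ξ D‖ := by
  have hm' : (0 : ℝ) < m := by exact_mod_cast hm
  have h1 : ∀ l ∈ Finset.Icc 1 m, ‖featureSum ξ (x ::ₘ D)‖ ^ 2 ≤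
      ‖featureSum ξ D‖ ^ 2 + a + 2 * inner ℝ (ξ (y l)) (featureSum ξ D) := by
    intro l hl
    have h2 : ‖featureSum ξ (x ::ₘ D)‖ ^ 2 ≤ ‖featureSum ξ (y l ::ₘ D)‖ ^ 2 :=
      norm_featureSum_sq_le_of_ksd_le hξ (by simp) (by simp) (h.2 l hl)
    rw [featureSum_cons (y l), norm_add_sq_real] at h2
    linarith [ha l hl]
  have h3 := Finset.sum_le_sum h1
  rw [Finset.sum_add_distrib, ← Finset.mul_sum, ← sum_inner] at h3
  simp only [Finset.sum_const, Nat.card_Icc, Nat.add_sub_cancel, nsmul_eq_mul] at h3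
  have h4 : (inner ℝ (∑ l ∈ Finset.Icc 1 m, ξ (y l)) (featureSum ξ D) : ℝ) ≤
      m * (‖(m : ℝ)⁻¹ • ∑ l ∈ Finset.Icc 1 m, ξ (y l)‖ * ‖featureSum ξ D‖) := by
    refine (real_inner_le_norm _ _).trans (le_of_eq ?_)
    rw [norm_smul, norm_inv, Real.norm_of_nonneg hm'.le]
    field_simp
  have h5 : (m : ℝ) * ‖featureSum ξ (x ::ₘ D)‖ ^ 2 ≤ m * (‖featureSum ξ D‖ ^ 2 + a +
      2 * ‖(m : ℝ)⁻¹ • ∑ l ∈ Finset.Icc 1 m, ξ (y l)‖ * ‖featureSum ξ D‖) := by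
    nlinarith
  exact le_of_mul_le_mul_left h5 hm'

/-- The dictionaries of online thinning: the squared norm of the feature sum is controlled by the
accumulated energy of the candidates and the norms of their mean features. -/
theorem KSDThinning.IsOnlineKSDT.norm_featureSum_sq_le (hξ : ∀ x y, inner ℝ (ξ x) (ξ y) = k₀ x y)
    {D₀ : Multiset α} {ε f : ℕ → ℝ} {n m : ℕ} {y : ℕ → ℕ → α} {D : ℕ → Multiset α} (hm : 0 < m)
    (h : IsOnlineKSDT k₀ D₀ ε f n (fun _ => m) y D) {a : ℕ → ℝ}
    (ha : ∀ i ∈ Finset.Icc 1 n, ∀ l ∈ Finset.Icc 1 m, ‖ξ (y i l)‖ ^ 2 ≤ a i) :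
    ‖featureSum ξ (D n)‖ ^ 2 ≤
      4 * (featureEnergy ξ D₀ + ‖featureSum ξ D₀‖ ^ 2 + ∑ i ∈ Finset.Icc 1 n, a i) +
        2 * (∑ i ∈ Finset.Icc 1 n, ‖(m : ℝ)⁻¹ • ∑ l ∈ Finset.Icc 1 m, ξ (y i l)‖) ^ 2 := by
  set b : ℕ → ℝ := fun i => ‖(m : ℝ)⁻¹ • ∑ l ∈ Finset.Icc 1 m, ξ (y i l)‖ with hb
  set A₀ := featureEnergy ξ D₀ + ‖featureSum ξ D₀‖ ^ 2 with hA₀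
  have hA₀nn : 0 ≤ A₀ := add_nonneg (featureEnergy_nonneg D₀) (sq_nonneg _)
  have hann : ∀ i ∈ Finset.Icc 1 n, 0 ≤ a i := fun i hi =>
    (sq_nonneg _).trans (ha i hi 1 (by simp; omega))
  set T := A₀ + ∑ i ∈ Finset.Icc 1 n, a i with hT
  have hTnn : 0 ≤ T := add_nonneg hA₀nn (Finset.sum_nonneg hann)
  have hpart : ∀ i ≤ n, ∑ j ∈ Finset.Icc 1 i, a j ≤ ∑ j ∈ Finset.Icc 1 n, a j := fun i hi =>
    Finset.sum_le_sum_of_subset_of_nonneg (Finset.Icc_subset_Icc_right hi)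
      fun j hj _ => hann j hj
  have hpart0 : ∀ i ≤ n, 0 ≤ ∑ j ∈ Finset.Icc 1 i, a j := fun i hi =>
    Finset.sum_nonneg fun j hj => hann j (Finset.Icc_subset_Icc_right hi hj)
  -- The offset `T`, which contains all of the `a j`, makes the bracket dominate the energy at every
  -- step, as thinning requires. The form `(√· + ∑ b)²` absorbs an increase by `a + 2 b ‖F‖`.
  have key : ∀ i ≤ n, ‖featureSum ξ (D i)‖ ^ 2 ≤
      (√(T + ∑ j ∈ Finset.Icc 1 i, a j) + ∑ j ∈ Finset.Icc 1 i, b j) ^ 2 ∧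
      featureEnergy ξ (D i) ≤ A₀ + ∑ j ∈ Finset.Icc 1 i, a j := by
    intro i
    induction i with
    | zero =>
      intro _
      rw [h.1]
      have h0 := featureEnergy_nonneg (ξ := ξ) D₀
      have h1 : ‖featureSum ξ D₀‖ ^ 2 ≤ T := by
        have := hpart0 n le_rfl
        rw [hT, hA₀]
        linarith
      simp only [Finset.Icc_eq_empty (show ¬ 1 ≤ 0 by omega), Finset.sum_empty, add_zero,
        Real.sq_sqrt hTnn]
      exact ⟨h1, by rw [hA₀]; nlinarith [sq_nonneg ‖featureSum ξ D₀‖]⟩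
    | succ i ih =>
      intro hi
      obtain ⟨ihF, ihT⟩ := ih (by omega)
      obtain ⟨x, hx, hthin⟩ := h.2 (i + 1) (by simp; omega)
      simp only [Nat.add_sub_cancel] at hx hthin
      have hai := hann (i + 1) (by simp; omega)
      have hgreedy := hx.norm_featureSum_sq_le hξ hm
        (ha (i + 1) (by simp; omega))
      rw [Finset.sum_Icc_succ_top (by omega), Finset.sum_Icc_succ_top (by omega)]
      set A := ∑ j ∈ Finset.Icc 1 i, a j with hA
      set β := ∑ j ∈ Finset.Icc 1 i, b j with hβ
      have hA0 : 0 ≤ A := hpart0 i (by omega)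
      have hβ0 : 0 ≤ β := Finset.sum_nonneg fun j _ => norm_nonneg _
      have hb0 : 0 ≤ b (i + 1) := norm_nonneg _
      have hs0 : 0 ≤ √(T + A) := Real.sqrt_nonneg _
      have hF' : ‖featureSum ξ (D i)‖ ≤ √(T + A) + β :=
        abs_le_of_sq_le_sq' ihF (by positivity) |>.2
      have hss : √(T + A) ≤ √(T + (A + a (i + 1))) := Real.sqrt_le_sqrt (by linarith)
      have hsq1 : √(T + A) ^ 2 = T + A := Real.sq_sqrt (by linarith)
      have hsq2 : √(T + (A + a (i + 1))) ^ 2 = T + (A + a (i + 1)) := Real.sq_sqrt (by linarith)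
      have hstep : ‖featureSum ξ (x ::ₘ D i)‖ ^ 2 ≤
          (√(T + (A + a (i + 1))) + (β + b (i + 1))) ^ 2 := by
        have h1 : b (i + 1) * ‖featureSum ξ (D i)‖ ≤ b (i + 1) * (√(T + A) + β) :=
          mul_le_mul_of_nonneg_left hF' hb0
        have h2 : √(T + A) * (β + b (i + 1)) ≤ √(T + (A + a (i + 1))) * (β + b (i + 1)) :=
          mul_le_mul_of_nonneg_right hss (by positivity)
        change _ ≤ _ + 2 * b (i + 1) * _ at hgreedy
        nlinarith [sq_nonneg (b (i + 1))]
      have hxe : featureEnergy ξ (x ::ₘ D i) ≤ A₀ + (A + a (i + 1)) := by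
        obtain ⟨l, hl, rfl⟩ := hx.1
        rw [featureEnergy_cons]
        linarith [ha (i + 1) (by simp; omega) l hl]
      refine hthin.le_and_le hξ ?_ hstep hxe
      have h3 := hpart (i + 1) hi
      rw [Finset.sum_Icc_succ_top (by omega)] at h3
      have h4 : 0 ≤ √(T + (A + a (i + 1))) * (β + b (i + 1)) := by positivity
      nlinarith [sq_nonneg (β + b (i + 1))]
  obtain ⟨hF, -⟩ := key n le_rfl
  have h1 := Real.sq_sqrt (show 0 ≤ T + ∑ j ∈ Finset.Icc 1 n, a j from
    add_nonneg hTnn (hpart0 n le_rfl))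
  have h2 : ∑ j ∈ Finset.Icc 1 n, a j ≤ T := by rw [hT]; linarith
  -- From `(u + v)² ≤ 2 u² + 2 v²` and `u² ≤ 2 T`.
  nlinarith [sq_nonneg (√(T + ∑ j ∈ Finset.Icc 1 n, a j) - ∑ j ∈ Finset.Icc 1 n, b j)]

end Thinning

/-! ### Joint laws along a Markov chain -/

section MarkovChain

variable {Ω α : Type*} [MeasurableSpace Ω] [MeasurableSpace α] {μ : Measure Ω}
  {K : Kernel α α} {m : ℕ} {Z : ℕ → Ω → α}

theorem isMarkovKernel_pow (K : Kernel α α) [IsMarkovKernel K] (t : ℕ) : IsMarkovKernel (K ^ t) := by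
  induction t with
  | zero =>
    rw [pow_zero]
    exact inferInstanceAs (IsMarkovKernel Kernel.id)
  | succ t ih =>
    rw [pow_succ']
    exact inferInstanceAs (IsMarkovKernel (K ∘ₖ (K ^ t)))

theorem lintegral_pow_succ (K : Kernel α α) (t : ℕ) (a : α) {g : α → ℝ≥0∞} (hg : Measurable g) :
    ∫⁻ z, g z ∂((K ^ (t + 1)) a) = ∫⁻ y, ∫⁻ z, g z ∂(K y) ∂((K ^ t) a) := by
  rw [pow_succ']
  exact Kernel.lintegral_comp K (K ^ t) a hg

theorem pow_zero_apply (K : Kernel α α) (a : α) : (K ^ 0) a = Measure.dirac a := by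
  rw [pow_zero]
  exact Kernel.id_apply a

variable [IsMarkovKernel K] [IsProbabilityMeasure μ]

/-- The Markov property given the whole history, applied to a function of one past coordinate `j`
and the next state. Keeping `j` free allows the induction on the lag below. -/
theorem KSDThinning.IsMarkovChain.lintegral_succ (hZ : IsMarkovChain μ K m Z) {j l : ℕ}
    (hjl : j ≤ l) (hl : l < m) {u : α × α → ℝ≥0∞} (hu : Measurable u) :
    ∫⁻ ω, u (Z j ω, Z (l + 1) ω) ∂μ = ∫⁻ ω, ∫⁻ z, u (Z j ω, z) ∂(K (Z l ω)) ∂μ := by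
  have hhist : Measurable fun ω (i : Fin (l + 1)) => Z i ω :=
    measurable_pi_lambda _ fun i => hZ.1 i (by omega)
  have hcd := hZ.2 l hl
  have hu' : Measurable fun q : (Fin (l + 1) → α) × α => u (q.1 ⟨j, by omega⟩, q.2) := by
    fun_prop
  have h1 := lintegral_map (μ := μ) hu' (hhist.prodMk (hZ.1 (l + 1) (by omega)))
  rw [hcd.map_eq, Measure.lintegral_compProd hu', lintegral_map hu'.lintegral_kernel_prod_right
    hhist] at h1
  simpa using h1.symm

theorem KSDThinning.IsMarkovChain.lintegral_pair (hZ : IsMarkovChain μ K m Z) {l t : ℕ}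
    (hlt : l + t ≤ m) {u : α × α → ℝ≥0∞} (hu : Measurable u) :
    ∫⁻ ω, u (Z l ω, Z (l + t) ω) ∂μ = ∫⁻ ω, ∫⁻ z, u (Z l ω, z) ∂((K ^ t) (Z l ω)) ∂μ := by
  induction t generalizing u with
  | zero =>
    simp only [pow_zero_apply, add_zero]
    refine lintegral_congr fun ω => ?_
    rw [lintegral_dirac' _ (by fun_prop)]
  | succ t ih =>
    have hu' : Measurable fun q : α × α => ∫⁻ z, u (q.1, z) ∂(K q.2) := by
      have h2 : Measurable (Function.uncurry fun (q : α × α) (z : α) => u (q.1, z)) := by fun_prop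
      exact h2.lintegral_kernel_prod_right' (κ := K.comap Prod.snd measurable_snd)
    rw [← add_assoc, hZ.lintegral_succ (Nat.le_add_right l t) (by omega) hu,
      ih (by omega) hu']
    refine lintegral_congr fun ω => ?_
    rw [lintegral_pow_succ K t _ (by fun_prop)]

theorem KSDThinning.IsMarkovChain.map_pair (hZ : IsMarkovChain μ K m Z) {l t : ℕ}
    (hlt : l + t ≤ m) :
    μ.map (fun ω => (Z l ω, Z (l + t) ω)) = (μ.map (Z l)) ⊗ₘ (K ^ t) := by
  have := isMarkovKernel_pow K t
  have hl := hZ.1 l (by omega)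
  refine Measure.ext_of_lintegral _ fun u hu => ?_
  rw [lintegral_map hu (hl.prodMk (hZ.1 (l + t) hlt)), hZ.lintegral_pair hlt hu,
    Measure.lintegral_compProd hu, lintegral_map hu.lintegral_kernel_prod_right' hl]

end MarkovChain

/-! ### Consequences of `V`-uniform ergodicity -/

section Ergodicity

variable {α : Type*} [MeasurableSpace α] {K : Kernel α α} {π : Measure α} {V : α → ℝ≥0∞} {R : ℝ≥0}
  {ρ : ℝ}

theorem ofReal_abs_integral_sub_le_vDist {μ ν : Measure α} {g : α → ℝ} (hg : Measurable g)
    (hb : ∃ c : ℝ, ∀ x, |g x| ≤ c) (hV : ∀ x, ENNReal.ofReal |g x| ≤ V x) :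
    ENNReal.ofReal |∫ x, g x ∂μ - ∫ x, g x ∂ν| ≤ vDist V μ ν :=
  le_iSup_of_le g (le_iSup_of_le hg (le_iSup_of_le hb (le_iSup_of_le hV le_rfl)))

theorem abs_integral_sub_le_of_vDist {μ ν : Measure α} (hV1 : ∀ x, 1 ≤ V x) {g : α → ℝ}
    (hg : Measurable g) {M D : ℝ} (hM : 0 ≤ M) (hgM : ∀ x, |g x| ≤ M) (hD : 0 ≤ D)
    (h : vDist V μ ν ≤ ENNReal.ofReal D) :
    |∫ x, g x ∂μ - ∫ x, g x ∂ν| ≤ M * D := by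
  rcases hM.eq_or_lt with rfl | hM
  · have h0 : ∀ x, g x = 0 := fun x => abs_nonpos_iff.mp (hgM x)
    simp [h0]
  · have hb : ∀ x, |M⁻¹ * g x| ≤ 1 := fun x => by
      rw [abs_mul, abs_of_pos (inv_pos.mpr hM), inv_mul_le_iff₀ hM, mul_one]
      exact hgM x
    have h1 := (ofReal_abs_integral_sub_le_vDist (V := V) (μ := μ) (ν := ν) (hg.const_mul M⁻¹)
      ⟨1, hb⟩ fun x => (ENNReal.ofReal_le_one.mpr (hb x)).trans (hV1 x)).trans h
    rw [ENNReal.ofReal_le_ofReal_iff hD, integral_const_mul, integral_const_mul, ← mul_sub,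
      abs_mul, abs_of_pos (inv_pos.mpr hM), inv_mul_le_iff₀ hM] at h1
    exact h1

/-- The bound of `V`-uniform ergodicity, interpolated with the trivial bound. -/
theorem abs_integral_pow_sub_le [IsMarkovKernel K] [IsProbabilityMeasure π] (hV1 : ∀ x, 1 ≤ V x)
    (hρ : 0 < ρ)
    (hE : ∀ (t : ℕ) (y : α), vDist V ((K ^ t) y) π ≤ R * V y * ENNReal.ofReal ρ ^ t)
    {g : α → ℝ} (hg : Measurable g) {M : ℝ} (hM : 0 ≤ M) (hgM : ∀ x, |g x| ≤ M) {y : α}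
    (hy : V y ≠ ∞) (t : ℕ) :
    |∫ x, g x ∂((K ^ t) y) - ∫ x, g x ∂π| ≤ M * (√(2 * R) * √ρ ^ t * √(V y).toReal) := by
  have := isMarkovKernel_pow K t
  have h1 : |∫ x, g x ∂((K ^ t) y) - ∫ x, g x ∂π| ≤ M * (R * (V y).toReal * ρ ^ t) := by
    refine abs_integral_sub_le_of_vDist hV1 hg hM hgM (by positivity) ((hE t y).trans_eq ?_)
    rw [ENNReal.ofReal_mul (by positivity), ENNReal.ofReal_mul (by positivity),
      ENNReal.ofReal_toReal hy, ENNReal.ofReal_pow hρ.le, ENNReal.ofReal_coe_nnreal]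
  have hb : ∀ (ν : Measure α) [IsProbabilityMeasure ν], |∫ x, g x ∂ν| ≤ M := fun ν _ => by
    simpa using norm_integral_le_of_norm_le_const (μ := ν) (f := g) (C := M)
      (Eventually.of_forall hgM)
  have h2 : |∫ x, g x ∂((K ^ t) y) - ∫ x, g x ∂π| ≤ 2 * M := by
    refine (abs_sub _ _).trans ?_
    linarith [hb ((K ^ t) y), hb π]
  set D := |∫ x, g x ∂((K ^ t) y) - ∫ x, g x ∂π|
  have hsq : √(2 * R) * √ρ ^ t * √(V y).toReal = √(2 * (R * (V y).toReal * ρ ^ t)) := by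
    have hpow : √ρ ^ t = √(ρ ^ t) := by
      rw [← Real.sqrt_sq (pow_nonneg (Real.sqrt_nonneg ρ) t), ← pow_mul, mul_comm, pow_mul,
        Real.sq_sqrt hρ.le]
    rw [hpow, ← Real.sqrt_mul (by positivity),
      ← Real.sqrt_mul (by positivity)]
    congr 1
    ring
  rw [hsq]
  -- Geometric mean of the two bounds: `D²` is at most the product of `2 * M` and the ergodic bound.
  -- Only `√V` remains, so first moments of `V` suffice later.
  refine abs_le_of_sq_le_sq' (a := D) ?_ (by positivity) |>.2
  rw [mul_pow, Real.sq_sqrt (by positivity)]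
  nlinarith [abs_nonneg (∫ x, g x ∂((K ^ t) y) - ∫ x, g x ∂π)]

/-- Both `K ^ t` and `K ^ 0 = id`, started at `y`, are within `R * V y` of `π` when tested against
`V`. Truncating `V` at `c` provides bounded test functions, and monotone convergence removes the
truncation. -/
theorem lintegral_pow_le [IsMarkovKernel K] [IsProbabilityMeasure π] (hVm : Measurable V)
    (hρ1 : ρ < 1)
    (hE : ∀ (t : ℕ) (y : α), vDist V ((K ^ t) y) π ≤ R * V y * ENNReal.ofReal ρ ^ t) (t : ℕ)
    (y : α) : ∫⁻ z, V z ∂((K ^ t) y) ≤ (1 + 2 * R) * V y := by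
  have := isMarkovKernel_pow K t
  have hsup : ∀ z, V z = ⨆ c : ℕ, min (V z) c := fun z => by
    rw [← inf_iSup_eq, ENNReal.iSup_natCast, inf_top_eq]
  have hmono : Monotone fun (c : ℕ) (z : α) => min (V z) (c : ℝ≥0∞) := fun a b hab z =>
    min_le_min_left _ (by exact_mod_cast hab)
  rw [lintegral_congr hsup, lintegral_iSup (fun c => hVm.min measurable_const) hmono]
  refine iSup_le fun c => ?_
  let g : α → ℝ := fun z => (min (V z) (c : ℝ≥0∞)).toReal
  have hfin : ∀ z, min (V z) (c : ℝ≥0∞) ≠ ∞ := fun z =>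
    ne_top_of_le_ne_top (ENNReal.natCast_ne_top c) (min_le_right _ _)
  have hg : Measurable g := (hVm.min measurable_const).ennreal_toReal
  have hgof : ∀ z, ENNReal.ofReal (g z) = min (V z) (c : ℝ≥0∞) := fun z =>
    ENNReal.ofReal_toReal (hfin z)
  have hg0 : ∀ z, 0 ≤ g z := fun z => ENNReal.toReal_nonneg
  have hgc : ∀ z, |g z| ≤ c := fun z => by
    rw [abs_of_nonneg (hg0 z)]
    simpa using ENNReal.toReal_mono (ENNReal.natCast_ne_top c) (min_le_right (V z) (c : ℝ≥0∞))
  have hgV : ∀ z, ENNReal.ofReal |g z| ≤ V z := fun z => by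
    rw [abs_of_nonneg (hg0 z), hgof]
    exact min_le_left _ _
  have hle : ∀ s : ℕ, ENNReal.ofReal |∫ z, g z ∂((K ^ s) y) - ∫ z, g z ∂π| ≤ R * V y := fun s => by
    refine (ofReal_abs_integral_sub_le_vDist hg ⟨c, hgc⟩ hgV).trans ((hE s y).trans ?_)
    exact mul_le_of_le_one_right' (pow_le_one' (ENNReal.ofReal_le_one.mpr hρ1.le) s)
  have h0 := hle 0
  rw [pow_zero_apply, integral_dirac' _ _ hg.stronglyMeasurable, abs_sub_comm] at h0
  have hInt : Integrable g ((K ^ t) y) :=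
    Integrable.of_bound hg.aestronglyMeasurable c (Eventually.of_forall hgc)
  calc ∫⁻ z, min (V z) c ∂((K ^ t) y) = ∫⁻ z, ENNReal.ofReal (g z) ∂((K ^ t) y) := by
        simp_rw [hgof]
    _ = ENNReal.ofReal (∫ z, g z ∂((K ^ t) y)) :=
        (ofReal_integral_eq_lintegral_ofReal hInt (Eventually.of_forall hg0)).symm
    _ ≤ ENNReal.ofReal (|∫ z, g z ∂((K ^ t) y) - ∫ z, g z ∂π| +
          |∫ z, g z ∂π - g y| + g y) := by
        refine ENNReal.ofReal_le_ofReal ?_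
        linarith [le_abs_self (∫ z, g z ∂((K ^ t) y) - ∫ z, g z ∂π),
          le_abs_self (∫ z, g z ∂π - g y)]
    _ ≤ ENNReal.ofReal |∫ z, g z ∂((K ^ t) y) - ∫ z, g z ∂π| +
          ENNReal.ofReal |∫ z, g z ∂π - g y| + ENNReal.ofReal (g y) :=
        ENNReal.ofReal_add_le.trans (add_le_add_left ENNReal.ofReal_add_le _)
    _ ≤ R * V y + R * V y + V y := by
        gcongr
        · exact hle t
        · rw [hgof]
          exact min_le_left _ _
    _ = (1 + 2 * R) * V y := by ring

end Ergodicity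

theorem integrable_and_integral_le_of_lintegral_le {Ω : Type*} [MeasurableSpace Ω] {μ : Measure Ω}
    {f : Ω → ℝ} (hf : AEStronglyMeasurable f μ) (h0 : ∀ x, 0 ≤ f x) {B : ℝ≥0}
    (h : ∫⁻ x, ENNReal.ofReal (f x) ∂μ ≤ B) : Integrable f μ ∧ ∫ x, f x ∂μ ≤ B := by
  have hi : Integrable f μ :=
    (lintegral_ofReal_ne_top_iff_integrable hf (Eventually.of_forall h0)).mp
      (ne_top_of_le_ne_top ENNReal.coe_ne_top h)
  refine ⟨hi, ?_⟩
  rw [← ofReal_integral_eq_lintegral_ofReal hi (Eventually.of_forall h0)] at h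
  rw [← ENNReal.ofReal_coe_nnreal] at h
  exact (ENNReal.ofReal_le_ofReal_iff B.2).mp h

theorem le_exp_div {γ : ℝ} (hγ : 0 < γ) (u : ℝ) : u ≤ Real.exp (γ * u) / γ := by
  rw [le_div_iff₀ hγ]
  linarith [Real.add_one_le_exp (γ * u)]

/-! ### Truncation and decay of covariances -/

section Covariance

variable {Ω α : Type*} [MeasurableSpace Ω] [MeasurableSpace α] {μ : Measure Ω}
  {K : Kernel α α} {π : Measure α} {V : α → ℝ≥0∞} {R B : ℝ≥0} {ρ γ : ℝ} {k₀ : α → α → ℝ} {n : ℕ}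
  {Z : ℕ → Ω → α}

/-- The kernel `k₀`, truncated in its second argument to the points with `k₀ z z ≤ s`. -/
noncomputable def truncKernel (k₀ : α → α → ℝ) (s : ℝ) (x z : α) : ℝ :=
  if k₀ z z ≤ s then k₀ x z else 0

theorem measurable_kernel_diag (hk : Measurable fun q : α × α => k₀ q.1 q.2) :
    Measurable fun z => k₀ z z :=
  hk.comp (measurable_id.prodMk measurable_id)

theorem measurable_truncKernel (hk : Measurable fun q : α × α => k₀ q.1 q.2) (s : ℝ) :
    Measurable fun q : α × α => truncKernel k₀ s q.1 q.2 :=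
  Measurable.ite (measurableSet_le ((measurable_kernel_diag hk).comp measurable_snd) measurable_const) hk
    measurable_const

theorem abs_truncKernel_le {α : Type*} {k₀ : α → α → ℝ}
    (hcs : ∀ x z, |k₀ x z| ≤ √(k₀ x x) * √(k₀ z z)) {s : ℝ} (x z : α) :
    |truncKernel k₀ s x z| ≤ √(k₀ x x) * √s := by
  unfold truncKernel
  split_ifs with h
  · exact (hcs x z).trans (mul_le_mul_of_nonneg_left (Real.sqrt_le_sqrt h) (Real.sqrt_nonneg _))
  · simpa using mul_nonneg (Real.sqrt_nonneg _) (Real.sqrt_nonneg _)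

/-- Where the truncation is active, `k₀ z z > (4 / γ) log n`, so `exp (γ k₀ z z / 2) ≥ n²`; half of
the exponential moment pays for the factor `1 / n`. -/
theorem abs_sub_truncKernel_le {α : Type*} {k₀ : α → α → ℝ} (hnn : ∀ x, 0 ≤ k₀ x x)
    (hcs : ∀ x z, |k₀ x z| ≤ √(k₀ x x) * √(k₀ z z)) (hγ : 0 < γ) (hn : 0 < n) (x z : α) :
    |k₀ x z - truncKernel k₀ (4 / γ * Real.log n) x z| ≤
      (Real.exp (γ * k₀ x x) + Real.exp (γ * k₀ z z)) / (γ * n) := by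
  have hn' : (0 : ℝ) < n := by exact_mod_cast hn
  unfold truncKernel
  split_ifs with h
  · rw [sub_self, abs_zero]
    positivity
  · rw [sub_zero]
    push Not at h
    set a := k₀ x x
    set b := k₀ z z
    -- AM-GM with weight `n`: the untruncated variable `x` gets the small factor `1 / n`, and the
    -- tail in `z` compensates the factor `n`.
    have h1 : |k₀ x z| ≤ (a / n + n * b) / 2 := by
      refine (hcs x z).trans ?_
      have e1 : √a * √b = √(a / n) * √(n * b) := by
        rw [← Real.sqrt_mul (hnn x), ← Real.sqrt_mul (div_nonneg (hnn x) hn'.le)]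
        congr 1
        field_simp
      rw [e1]
      nlinarith [sq_nonneg (√(a / n) - √(n * b)), Real.sq_sqrt (div_nonneg (hnn x) hn'.le),
        Real.sq_sqrt (mul_nonneg hn'.le (hnn z))]
    have h2 : a ≤ Real.exp (γ * a) / γ := le_exp_div hγ a
    have h3 : b ≤ Real.exp (γ / 2 * b) / (γ / 2) := le_exp_div (by positivity) b
    have h4 : (n : ℝ) ^ 2 ≤ Real.exp (γ / 2 * b) := by
      have e2 : (n : ℝ) ^ 2 = Real.exp (2 * Real.log n) := by
        rw [mul_comm, Real.exp_mul, Real.exp_log hn']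
        norm_num
      rw [e2]
      refine Real.exp_le_exp.mpr ?_
      calc 2 * Real.log n = γ / 2 * (4 / γ * Real.log n) := by field_simp; ring
        _ ≤ γ / 2 * b := by gcongr
    have h5 : Real.exp (γ * b) = Real.exp (γ / 2 * b) * Real.exp (γ / 2 * b) := by
      rw [← Real.exp_add]
      congr 1
      ring
    refine h1.trans ?_
    rw [le_div_iff₀ (by positivity), h5]
    rw [le_div_iff₀ hγ] at h2
    rw [le_div_iff₀ (by positivity)] at h3
    set w := Real.exp (γ / 2 * b)
    have hw : 0 < w := Real.exp_pos _
    have h6 : (n : ℝ) ^ 2 * (b * (γ / 2)) ≤ w * w := by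
      calc (n : ℝ) ^ 2 * (b * (γ / 2)) ≤ (n : ℝ) ^ 2 * w := by gcongr
        _ ≤ w * w := by gcongr
    have e3 : (a / n + n * b) / 2 * (γ * n) = a * γ / 2 + (n : ℝ) ^ 2 * (b * (γ / 2)) := by
      field_simp
    rw [e3]
    have := mul_nonneg (hnn x) hγ.le
    linarith

/-- As `k₀ x` has mean zero, the mean of its truncation is minus the mean of the tail. -/
theorem abs_integral_truncKernel_le [IsProbabilityMeasure π]
    (hk : Measurable fun q : α × α => k₀ q.1 q.2) (hnn : ∀ x, 0 ≤ k₀ x x)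
    (hcs : ∀ x z, |k₀ x z| ≤ √(k₀ x x) * √(k₀ z z)) (hγ : 0 < γ) (hn : 0 < n)
    (hmean : ∀ x, ∫ z, k₀ x z ∂π = 0) (hπ : Integrable (fun z => Real.exp (γ * k₀ z z)) π)
    (x : α) :
    |∫ z, truncKernel k₀ (4 / γ * Real.log n) x z ∂π| ≤
      (Real.exp (γ * k₀ x x) + ∫ z, Real.exp (γ * k₀ z z) ∂π) / (γ * n) := by
  set s := 4 / γ * Real.log n
  have hgm : Measurable (truncKernel k₀ s x) := (measurable_truncKernel hk s).of_uncurry_left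
  have hkm : Measurable (k₀ x) := hk.of_uncurry_left
  have hg : Integrable (truncKernel k₀ s x) π :=
    Integrable.of_bound hgm.aestronglyMeasurable _
      (Eventually.of_forall (abs_truncKernel_le hcs x))
  have hbd : Integrable (fun z => (Real.exp (γ * k₀ x x) + Real.exp (γ * k₀ z z)) / (γ * n)) π :=
    ((integrable_const _).add hπ).div_const _
  have hdiff : Integrable (fun z => k₀ x z - truncKernel k₀ s x z) π :=
    hbd.mono' (hkm.sub hgm).aestronglyMeasurable
      (Eventually.of_forall (abs_sub_truncKernel_le hnn hcs hγ hn x))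
  have hkx : Integrable (k₀ x) π := (hdiff.add hg).congr
    (Eventually.of_forall fun z => by simp)
  have h1 : ∫ z, truncKernel k₀ s x z ∂π = - ∫ z, (k₀ x z - truncKernel k₀ s x z) ∂π := by
    rw [integral_sub hkx hg, hmean]
    ring
  rw [h1, abs_neg]
  refine (norm_integral_le_of_norm_le (f := fun z => k₀ x z - truncKernel k₀ s x z) hbd
    (Eventually.of_forall (abs_sub_truncKernel_le hnn hcs hγ hn x))).trans_eq ?_
  rw [integral_div, integral_add (integrable_const _) hπ]
  simp

/-- Exponential decay of the kernel covariances along a `V`-uniformly ergodic chain. -/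
theorem KSDThinning.IsMarkovChain.integral_kernel_le [IsMarkovKernel K] [IsProbabilityMeasure π]
    [IsProbabilityMeasure μ] (hZ : IsMarkovChain μ K n Z)
    (hk : Measurable fun q : α × α => k₀ q.1 q.2) (hnn : ∀ x, 0 ≤ k₀ x x)
    (hcs : ∀ x z, |k₀ x z| ≤ √(k₀ x x) * √(k₀ z z)) (hγ : 0 < γ) (hn : 0 < n)
    (hmean : ∀ x, ∫ z, k₀ x z ∂π = 0) (hπ : Integrable (fun z => Real.exp (γ * k₀ z z)) π)
    (hVm : Measurable V) (hV1 : ∀ x, 1 ≤ V x) (hρ : 0 < ρ) (hρ1 : ρ < 1)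
    (hE : ∀ (t : ℕ) (y : α), vDist V ((K ^ t) y) π ≤ R * V y * ENNReal.ofReal ρ ^ t)
    (hV0 : ∫⁻ ω, V (Z 0 ω) ∂μ ≤ B)
    (hexp : ∀ l ∈ Finset.Icc 1 n,
      ∫⁻ ω, ENNReal.ofReal (Real.exp (γ * k₀ (Z l ω) (Z l ω))) ∂μ ≤ B)
    {l t : ℕ} (hl : 1 ≤ l) (hlt : l + t ≤ n) :
    ∫ ω, k₀ (Z l ω) (Z (l + t) ω) ∂μ ≤
      √(4 / γ * Real.log n) * √(2 * R) * ((B / γ + (1 + 2 * R) * B) / 2) * √ρ ^ t +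
        (3 * B + ∫ z, Real.exp (γ * k₀ z z) ∂π) / (γ * n) := by
  have := isMarkovKernel_pow K t
  set s := 4 / γ * Real.log n
  set Bπ := ∫ z, Real.exp (γ * k₀ z z) ∂π
  have hn' : (0 : ℝ) < n := by exact_mod_cast hn
  have hZl := hZ.1 l (by omega)
  have hZr := hZ.1 (l + t) hlt
  have hZlr : Measurable fun ω => (Z l ω, Z (l + t) ω) := hZl.prodMk hZr
  have hexpm : Measurable fun x => Real.exp (γ * k₀ x x) := ((measurable_kernel_diag hk).const_mul γ).exp
  obtain ⟨hel, hel'⟩ := integrable_and_integral_le_of_lintegral_le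
    (f := fun ω => Real.exp (γ * k₀ (Z l ω) (Z l ω))) (hexpm.comp hZl).aestronglyMeasurable (fun ω => (Real.exp_pos _).le)
    (hexp l (by simp; omega))
  obtain ⟨her, her'⟩ := integrable_and_integral_le_of_lintegral_le
    (f := fun ω => Real.exp (γ * k₀ (Z (l + t) ω) (Z (l + t) ω))) (hexpm.comp hZr).aestronglyMeasurable (fun ω => (Real.exp_pos _).le)
    (hexp (l + t) (by simp; omega))
  -- moments of `V` along the chain
  have hVl : ∫⁻ ω, V (Z l ω) ∂μ ≤ ((1 + 2 * R) * B : ℝ≥0) := by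
    have h1 := hZ.lintegral_pair (l := 0) (t := l) (by omega) (hVm.comp measurable_snd)
    simp only [Function.comp_apply, zero_add] at h1
    rw [h1]
    calc _ ≤ ∫⁻ ω, (1 + 2 * R) * V (Z 0 ω) ∂μ :=
          lintegral_mono fun ω => lintegral_pow_le hVm hρ1 hE l _
      _ = (1 + 2 * R) * ∫⁻ ω, V (Z 0 ω) ∂μ :=
          lintegral_const_mul _ (hVm.comp (hZ.1 0 (by omega)))
      _ ≤ (1 + 2 * R) * B := by gcongr
      _ = _ := by push_cast; rfl
  have hVZ : Measurable fun ω => V (Z l ω) := hVm.comp hZl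
  have hVtop : ∫⁻ ω, V (Z l ω) ∂μ ≠ ∞ := ne_top_of_le_ne_top ENNReal.coe_ne_top hVl
  have hVae : ∀ᵐ ω ∂μ, V (Z l ω) < ∞ := ae_lt_top hVZ hVtop
  have hVint : Integrable (fun ω => (V (Z l ω)).toReal) μ :=
    integrable_toReal_of_lintegral_ne_top hVZ.aemeasurable hVtop
  have hVreal : ∫ ω, (V (Z l ω)).toReal ∂μ ≤ (1 + 2 * R) * B := by
    rw [integral_toReal hVZ.aemeasurable hVae]
    have h := ENNReal.toReal_mono ENNReal.coe_ne_top hVl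
    rw [ENNReal.coe_toReal] at h
    push_cast at h
    exact h
  -- truncation
  have hgm := measurable_truncKernel hk s
  have hsqrt : ∀ x, √(k₀ x x) ≤ Real.exp (γ * k₀ x x) / γ + 1 := fun x => by
    nlinarith [Real.sq_sqrt (hnn x), sq_nonneg (√(k₀ x x) - 1), le_exp_div hγ (k₀ x x)]
  have hgint : Integrable (fun ω => truncKernel k₀ s (Z l ω) (Z (l + t) ω)) μ := by
    refine (((hel.div_const γ).add (integrable_const 1)).mul_const √s).mono'
      (hgm.comp hZlr).aestronglyMeasurable (Eventually.of_forall fun ω => ?_)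
    exact (abs_truncKernel_le hcs _ _).trans
      (mul_le_mul_of_nonneg_right (hsqrt _) (Real.sqrt_nonneg _))
  have htail : Integrable (fun ω => (Real.exp (γ * k₀ (Z l ω) (Z l ω)) +
      Real.exp (γ * k₀ (Z (l + t) ω) (Z (l + t) ω))) / (γ * n)) μ := (hel.add her).div_const _
  have hdiff : Integrable (fun ω => k₀ (Z l ω) (Z (l + t) ω) -
      truncKernel k₀ s (Z l ω) (Z (l + t) ω)) μ :=
    htail.mono' ((hk.comp hZlr).sub (hgm.comp hZlr)).aestronglyMeasurable
      (Eventually.of_forall fun ω => abs_sub_truncKernel_le hnn hcs hγ hn _ _)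
  have hsplit : ∫ ω, k₀ (Z l ω) (Z (l + t) ω) ∂μ ≤
      ∫ ω, truncKernel k₀ s (Z l ω) (Z (l + t) ω) ∂μ + 2 * B / (γ * n) := by
    have h1 : ∫ ω, (k₀ (Z l ω) (Z (l + t) ω) - truncKernel k₀ s (Z l ω) (Z (l + t) ω)) ∂μ ≤
        2 * B / (γ * n) := by
      refine (integral_mono hdiff htail fun ω =>
        (le_abs_self _).trans (abs_sub_truncKernel_le hnn hcs hγ hn _ _)).trans ?_
      rw [integral_div, integral_add hel her]
      gcongr
      linarith
    have h2 : ∫ ω, k₀ (Z l ω) (Z (l + t) ω) ∂μ =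
        ∫ ω, (k₀ (Z l ω) (Z (l + t) ω) - truncKernel k₀ s (Z l ω) (Z (l + t) ω)) ∂μ +
          ∫ ω, truncKernel k₀ s (Z l ω) (Z (l + t) ω) ∂μ := by
      rw [← integral_add hdiff hgint]
      simp
    linarith
  -- the truncated part
  have hgmap : Integrable (fun q : α × α => truncKernel k₀ s q.1 q.2)
      ((μ.map (Z l)) ⊗ₘ (K ^ t)) := by
    rw [← hZ.map_pair hlt]
    exact (integrable_map_measure hgm.aestronglyMeasurable hZlr.aemeasurable).mpr hgint
  have hcond : ∫ ω, truncKernel k₀ s (Z l ω) (Z (l + t) ω) ∂μ =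
      ∫ ω, ∫ z, truncKernel k₀ s (Z l ω) z ∂((K ^ t) (Z l ω)) ∂μ := by
    have h1 := integral_map (μ := μ) hZlr.aemeasurable
      (f := fun q : α × α => truncKernel k₀ s q.1 q.2) hgm.aestronglyMeasurable
    rw [← h1, hZ.map_pair hlt, Measure.integral_compProd hgmap, integral_map hZl.aemeasurable]
    exact hgm.stronglyMeasurable.integral_kernel_prod_right'.aestronglyMeasurable
  have hin : Integrable (fun ω => ∫ z, truncKernel k₀ s (Z l ω) z ∂((K ^ t) (Z l ω))) μ := by
    have h1 : StronglyMeasurable fun x => ∫ z, truncKernel k₀ s x z ∂((K ^ t) x) :=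
      hgm.stronglyMeasurable.integral_kernel_prod_right'
    refine (((hel.div_const γ).add (integrable_const 1)).mul_const √s).mono'
      (h1.comp_measurable hZl).aestronglyMeasurable (Eventually.of_forall fun ω => ?_)
    refine (norm_integral_le_of_norm_le_const (μ := (K ^ t) (Z l ω))
      (Eventually.of_forall (abs_truncKernel_le hcs (Z l ω)))).trans ?_
    simpa using mul_le_mul_of_nonneg_right (hsqrt (Z l ω)) (Real.sqrt_nonneg s)
  -- Deviation of `K ^ t` from `π` plus the `π`-mean of the truncation; AM-GM splits `√k₀ * √V` into
  -- separately integrable terms.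
  have hbound : ∀ᵐ ω ∂μ, ∫ z, truncKernel k₀ s (Z l ω) z ∂((K ^ t) (Z l ω)) ≤
      √s * √(2 * R) * √ρ ^ t *
        ((Real.exp (γ * k₀ (Z l ω) (Z l ω)) / γ + (V (Z l ω)).toReal) / 2) +
        (Real.exp (γ * k₀ (Z l ω) (Z l ω)) + Bπ) / (γ * n) := by
    filter_upwards [hVae] with ω hω
    have h1 := abs_integral_pow_sub_le hV1 hρ hE (g := truncKernel k₀ s (Z l ω))
      hgm.of_uncurry_left (M := √(k₀ (Z l ω) (Z l ω)) * √s) (by positivity)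
      (abs_truncKernel_le hcs (Z l ω)) hω.ne t
    have h2 := abs_integral_truncKernel_le hk hnn hcs hγ hn hmean hπ (Z l ω)
    have h3 : √(k₀ (Z l ω) (Z l ω)) * √(V (Z l ω)).toReal ≤
        (Real.exp (γ * k₀ (Z l ω) (Z l ω)) / γ + (V (Z l ω)).toReal) / 2 := by
      nlinarith [Real.sq_sqrt (hnn (Z l ω)), le_exp_div hγ (k₀ (Z l ω) (Z l ω)),
        sq_nonneg (√(k₀ (Z l ω) (Z l ω)) - √(V (Z l ω)).toReal),
        Real.sq_sqrt (ENNReal.toReal_nonneg (a := V (Z l ω)))]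
    have h4 : √(k₀ (Z l ω) (Z l ω)) * √s * (√(2 * R) * √ρ ^ t * √(V (Z l ω)).toReal) ≤
        √s * √(2 * R) * √ρ ^ t *
          ((Real.exp (γ * k₀ (Z l ω) (Z l ω)) / γ + (V (Z l ω)).toReal) / 2) := by
      calc _ = √s * √(2 * R) * √ρ ^ t * (√(k₀ (Z l ω) (Z l ω)) * √(V (Z l ω)).toReal) := by ring
        _ ≤ _ := by gcongr
    linarith [le_abs_self (∫ z, truncKernel k₀ s (Z l ω) z ∂((K ^ t) (Z l ω)) -
      ∫ z, truncKernel k₀ s (Z l ω) z ∂π), le_abs_self (∫ z, truncKernel k₀ s (Z l ω) z ∂π)]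
  have hi1 : Integrable (fun ω => √s * √(2 * R) * √ρ ^ t *
        ((Real.exp (γ * k₀ (Z l ω) (Z l ω)) / γ + (V (Z l ω)).toReal) / 2)) μ :=
    (((hel.div_const γ).add hVint).div_const 2).const_mul _
  have hi2 : Integrable (fun ω => (Real.exp (γ * k₀ (Z l ω) (Z l ω)) + Bπ) / (γ * n)) μ :=
    (hel.add (integrable_const Bπ)).div_const _
  have hmain := integral_mono_ae hin (hi1.add hi2) hbound
  simp only [Pi.add_apply] at hmain
  rw [integral_add hi1 hi2, integral_const_mul, integral_div, integral_div,
    integral_add (hel.div_const γ) hVint, integral_add hel (integrable_const _), integral_div] at hmain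
  simp only [integral_const, probReal_univ, one_smul] at hmain
  rw [hcond] at hsplit
  have h5 : √s * √(2 * R) * √ρ ^ t *
      ((∫ ω, Real.exp (γ * k₀ (Z l ω) (Z l ω)) ∂μ) / γ + ∫ ω, (V (Z l ω)).toReal ∂μ) / 2 ≤
      √s * √(2 * R) * ((B / γ + (1 + 2 * R) * B) / 2) * √ρ ^ t := by
    calc _ ≤ √s * √(2 * R) * √ρ ^ t * (B / γ + (1 + 2 * R) * B) / 2 := by gcongr
      _ = _ := by ring
  have h6 : ((∫ ω, Real.exp (γ * k₀ (Z l ω) (Z l ω)) ∂μ) + Bπ) / (γ * n) ≤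
      (B + Bπ) / (γ * n) := by gcongr
  have h7 : 2 * B / (γ * n) + (B + Bπ) / (γ * n) = (3 * B + Bπ) / (γ * n) := by ring
  rw [mul_div_assoc] at h5
  linarith

end Covariance

theorem sum_pow_injOn_le {ι : Type*} {θ : ℝ} (h0 : 0 ≤ θ) (h1 : θ < 1) (s : Finset ι) {e : ι → ℕ}
    (he : Set.InjOn e s) : ∑ i ∈ s, θ ^ e i ≤ (1 - θ)⁻¹ := by
  classical
  rw [← Finset.sum_image (f := fun t => θ ^ t) he, ← tsum_geometric_of_lt_one h0 h1]
  exact (summable_geometric_of_lt_one h0 h1).sum_le_tsum _ fun t _ => pow_nonneg h0 t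

/-- With truncated subtraction the exponent is `|l - r|`; either side of `l` contributes a geometric
series. -/
theorem sum_pow_dist_le {θ : ℝ} (h0 : 0 ≤ θ) (h1 : θ < 1) (s : Finset ℕ) (l : ℕ) :
    ∑ r ∈ s, θ ^ (l - r + (r - l)) ≤ 2 * (1 - θ)⁻¹ := by
  rw [← Finset.sum_filter_add_sum_filter_not s (· ≤ l), two_mul]
  refine add_le_add (sum_pow_injOn_le h0 h1 _ ?_) (sum_pow_injOn_le h0 h1 _ ?_)
  · intro a ha b hb hab
    simp at ha hb hab
    omega
  · intro a ha b hb hab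
    simp at ha hb hab
    omega

/-! ### Second moment of the mean feature of a chain -/

section MeanFeature

variable {Ω α H : Type*} [MeasurableSpace Ω] [MeasurableSpace α] [NormedAddCommGroup H]
  [InnerProductSpace ℝ H] {μ : Measure Ω} {K : Kernel α α} {π : Measure α} {V : α → ℝ≥0∞}
  {R B : ℝ≥0} {ρ γ : ℝ} {k₀ : α → α → ℝ} {ξ : α → H} {n : ℕ} {Z : ℕ → Ω → α}

theorem abs_kernel_le {α : Type*} {k₀ : α → α → ℝ} {ξ : α → H}
    (hξ : ∀ x y, inner ℝ (ξ x) (ξ y) = k₀ x y) (x z : α) :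
    |k₀ x z| ≤ √(k₀ x x) * √(k₀ z z) := by
  rw [← hξ, ← hξ, ← hξ, real_inner_self_eq_norm_sq, real_inner_self_eq_norm_sq,
    Real.sqrt_sq (norm_nonneg _), Real.sqrt_sq (norm_nonneg _)]
  exact abs_real_inner_le_norm _ _

/-- The second moment of the mean feature along a `V`-uniformly ergodic chain of length `n` is
of order `(1 + √log n) / n`. -/
theorem KSDThinning.IsMarkovChain.integral_norm_mean_sq_le [IsMarkovKernel K]
    [IsProbabilityMeasure π] [IsProbabilityMeasure μ] (hZ : IsMarkovChain μ K n Z)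
    (hk : Measurable fun q : α × α => k₀ q.1 q.2) (hξ : ∀ x y, inner ℝ (ξ x) (ξ y) = k₀ x y)
    (hγ : 0 < γ) (hn : 0 < n)
    (hmean : ∀ x, ∫ z, k₀ x z ∂π = 0) (hπ : Integrable (fun z => Real.exp (γ * k₀ z z)) π)
    (hVm : Measurable V) (hV1 : ∀ x, 1 ≤ V x) (hρ : 0 < ρ) (hρ1 : ρ < 1)
    (hE : ∀ (t : ℕ) (y : α), vDist V ((K ^ t) y) π ≤ R * V y * ENNReal.ofReal ρ ^ t)
    (hV0 : ∫⁻ ω, V (Z 0 ω) ∂μ ≤ B)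
    (hexp : ∀ l ∈ Finset.Icc 1 n,
      ∫⁻ ω, ENNReal.ofReal (Real.exp (γ * k₀ (Z l ω) (Z l ω))) ∂μ ≤ B) :
    Integrable (fun ω => ‖(n : ℝ)⁻¹ • ∑ l ∈ Finset.Icc 1 n, ξ (Z l ω)‖ ^ 2) μ ∧
    ∫ ω, ‖(n : ℝ)⁻¹ • ∑ l ∈ Finset.Icc 1 n, ξ (Z l ω)‖ ^ 2 ∂μ ≤
      (√(4 / γ * Real.log n) * √(2 * R) * ((B / γ + (1 + 2 * R) * B) / 2) * (2 * (1 - √ρ)⁻¹) +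
        (3 * B + ∫ z, Real.exp (γ * k₀ z z) ∂π) / γ) / n := by
  have hn' : (0 : ℝ) < n := by exact_mod_cast hn
  have hnn : ∀ x, 0 ≤ k₀ x x := fun x => by
    rw [← hξ]
    exact real_inner_self_nonneg
  have hcs := abs_kernel_le hξ
  have hsymm : ∀ x y, k₀ x y = k₀ y x := fun x y => by rw [← hξ, ← hξ, real_inner_comm]
  set A := √(4 / γ * Real.log n) * √(2 * R) * ((B / γ + (1 + 2 * R) * B) / 2)
  set C := 3 * B + ∫ z, Real.exp (γ * k₀ z z) ∂π
  have hA : 0 ≤ A := by positivity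
  have hθ : √ρ < 1 := by
    rw [Real.sqrt_lt' one_pos]
    simpa using hρ1
  have hexpm : Measurable fun x => Real.exp (γ * k₀ x x) :=
    ((measurable_kernel_diag hk).const_mul γ).exp
  have hei : ∀ l ∈ Finset.Icc 1 n,
      Integrable (fun ω => Real.exp (γ * k₀ (Z l ω) (Z l ω))) μ := fun l hl =>
    (integrable_and_integral_le_of_lintegral_le
      (hexpm.comp (hZ.1 l (Finset.mem_Icc.mp hl).2)).aestronglyMeasurable
      (fun ω => (Real.exp_pos _).le) (hexp l hl)).1
  have hInt : ∀ l ∈ Finset.Icc 1 n, ∀ r ∈ Finset.Icc 1 n,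
      Integrable (fun ω => k₀ (Z l ω) (Z r ω)) μ := by
    intro l hl r hr
    refine (((hei l hl).add (hei r hr)).div_const γ).mono'
      (hk.comp ((hZ.1 l (Finset.mem_Icc.mp hl).2).prodMk
        (hZ.1 r (Finset.mem_Icc.mp hr).2))).aestronglyMeasurable
      (Eventually.of_forall fun ω => (hcs _ _).trans ?_)
    simp only [Pi.add_apply, add_div]
    nlinarith [Real.sq_sqrt (hnn (Z l ω)), Real.sq_sqrt (hnn (Z r ω)),
      sq_nonneg (√(k₀ (Z l ω) (Z l ω)) - √(k₀ (Z r ω) (Z r ω))), hnn (Z l ω), hnn (Z r ω),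
      le_exp_div hγ (k₀ (Z l ω) (Z l ω)), le_exp_div hγ (k₀ (Z r ω) (Z r ω))]
  -- Symmetry of `k₀` reduces to the case where the earlier time comes first.
  have hpair : ∀ l ∈ Finset.Icc 1 n, ∀ r ∈ Finset.Icc 1 n,
      ∫ ω, k₀ (Z l ω) (Z r ω) ∂μ ≤ A * √ρ ^ (l - r + (r - l)) + C / (γ * n) := by
    intro l hl r hr
    rw [Finset.mem_Icc] at hl hr
    rcases le_total l r with h | h
    · obtain ⟨t, rfl⟩ := Nat.exists_eq_add_of_le h
      have e : l - (l + t) + (l + t - l) = t := by omega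
      rw [e]
      exact hZ.integral_kernel_le hk hnn hcs hγ hn hmean hπ hVm hV1 hρ hρ1 hE hV0 hexp hl.1 hr.2
    · obtain ⟨t, rfl⟩ := Nat.exists_eq_add_of_le h
      have e : r + t - r + (r - (r + t)) = t := by omega
      rw [e]
      simp only [hsymm (Z (r + t) _)]
      exact hZ.integral_kernel_le hk hnn hcs hγ hn hmean hπ hVm hV1 hρ hρ1 hE hV0 hexp hr.1 hl.2
  have hexpand : ∀ ω, ‖(n : ℝ)⁻¹ • ∑ l ∈ Finset.Icc 1 n, ξ (Z l ω)‖ ^ 2 =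
      ((n : ℝ)⁻¹) ^ 2 * ∑ l ∈ Finset.Icc 1 n, ∑ r ∈ Finset.Icc 1 n, k₀ (Z l ω) (Z r ω) := by
    intro ω
    rw [norm_smul, mul_pow, norm_inv, Real.norm_of_nonneg hn'.le, ← real_inner_self_eq_norm_sq,
      sum_inner]
    simp only [inner_sum, hξ]
  simp only [hexpand]
  have hrow : ∀ l ∈ Finset.Icc 1 n,
      Integrable (fun ω => ∑ r ∈ Finset.Icc 1 n, k₀ (Z l ω) (Z r ω)) μ := fun l hl =>
    integrable_finsetSum _ fun r hr => hInt l hl r hr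
  refine ⟨(integrable_finsetSum _ hrow).const_mul _, ?_⟩
  rw [integral_const_mul, integral_finsetSum _ hrow]
  have hsum : ∑ l ∈ Finset.Icc 1 n, ∫ ω, ∑ r ∈ Finset.Icc 1 n, k₀ (Z l ω) (Z r ω) ∂μ ≤
      n * (A * (2 * (1 - √ρ)⁻¹) + C / γ) := by
    have h1 : ∀ l ∈ Finset.Icc 1 n, ∫ ω, ∑ r ∈ Finset.Icc 1 n, k₀ (Z l ω) (Z r ω) ∂μ ≤
        A * (2 * (1 - √ρ)⁻¹) + C / γ := by
      intro l hl
      rw [integral_finsetSum _ fun r hr => hInt l hl r hr]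
      refine (Finset.sum_le_sum fun r hr => hpair l hl r hr).trans ?_
      rw [Finset.sum_add_distrib, ← Finset.mul_sum]
      refine add_le_add (mul_le_mul_of_nonneg_left
        (sum_pow_dist_le (Real.sqrt_nonneg ρ) hθ _ l) hA) (le_of_eq ?_)
      simp only [Finset.sum_const, Nat.card_Icc, Nat.add_sub_cancel, nsmul_eq_mul]
      field_simp
    refine (Finset.sum_le_sum h1).trans_eq ?_
    rw [Finset.sum_const, Nat.card_Icc, Nat.add_sub_cancel, nsmul_eq_mul]
  calc _ ≤ ((n : ℝ)⁻¹) ^ 2 * (n * (A * (2 * (1 - √ρ)⁻¹) + C / γ)) := by gcongr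
    _ = _ := by field_simp

/-- The pointwise bound on the energy of a candidate by the empirical exponential moment. -/
theorem le_log_add_sum_exp {s : Finset ℕ} (hγ : 0 < γ) (hn : 0 < n) (a : ℕ → ℝ) {l : ℕ}
    (hl : l ∈ s) : a l ≤ (Real.log n + (∑ j ∈ s, Real.exp (γ * a j)) / n) / γ := by
  have hn' : (0 : ℝ) < n := by exact_mod_cast hn
  have h1 : Real.exp (γ * a l) ≤ ∑ j ∈ s, Real.exp (γ * a j) :=
    Finset.single_le_sum (f := fun j => Real.exp (γ * a j)) (fun j _ => (Real.exp_pos _).le) hl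
  -- The inequality `u + 1 ≤ exp u` at `u = γ a - log n`: the maximum over `n` candidates costs only
  -- `log n`.
  have h2 : γ * a l - Real.log n ≤ Real.exp (γ * a l) / n := by
    have := Real.add_one_le_exp (γ * a l - Real.log n)
    rw [Real.exp_sub, Real.exp_log hn'] at this
    linarith
  have h3 : Real.exp (γ * a l) / n ≤ (∑ j ∈ s, Real.exp (γ * a j)) / n := by gcongr
  rw [le_div_iff₀ hγ]
  linarith

end MeanFeature

/-! ### Expectation of the pathwise bound -/

section Online

variable {Ω α H : Type*} [MeasurableSpace Ω] [MeasurableSpace α] [NormedAddCommGroup H]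
  [InnerProductSpace ℝ H] {μ : Measure Ω} {K : Kernel α α} {π : Measure α} {V : α → ℝ≥0∞}
  {R B : ℝ≥0} {ρ γ : ℝ} {k₀ : α → α → ℝ} {ξ : α → H} {n : ℕ}

/-- A bound on the squared norm of the feature sum that is produced by online thinning, in terms of
the candidates alone. -/
noncomputable def onlineBound (γ : ℝ) (k₀ : α → α → ℝ) (ξ : α → H) (A : ℝ) (n : ℕ)
    (y : ℕ → ℕ → α) : ℝ :=
  4 * (A + ∑ i ∈ Finset.Icc 1 n,
      (Real.log n + (∑ l ∈ Finset.Icc 1 n, Real.exp (γ * k₀ (y i l) (y i l))) / n) / γ) +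
    2 * (n * ∑ i ∈ Finset.Icc 1 n, ‖(n : ℝ)⁻¹ • ∑ l ∈ Finset.Icc 1 n, ξ (y i l)‖ ^ 2)

/-- The right side depends on the candidates alone, so no measurability of the dictionaries is
needed when taking expectations. -/
theorem KSDThinning.IsOnlineKSDT.norm_featureSum_sq_le_onlineBound {α : Type*} {k₀ : α → α → ℝ}
    {ξ : α → H} (hξ : ∀ x y, inner ℝ (ξ x) (ξ y) = k₀ x y) (hγ : 0 < γ) (hn : 0 < n)
    {D₀ : Multiset α} {ε f : ℕ → ℝ} {y : ℕ → ℕ → α} {D : ℕ → Multiset α}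
    (h : IsOnlineKSDT k₀ D₀ ε f n (fun _ => n) y D) :
    ‖featureSum ξ (D n)‖ ^ 2 ≤
      onlineBound γ k₀ ξ (featureEnergy ξ D₀ + ‖featureSum ξ D₀‖ ^ 2) n y := by
  refine (h.norm_featureSum_sq_le hξ hn (a := fun i => (Real.log n +
    (∑ l ∈ Finset.Icc 1 n, Real.exp (γ * k₀ (y i l) (y i l))) / n) / γ) fun i hi l hl => ?_).trans ?_
  · rw [← real_inner_self_eq_norm_sq, hξ]
    exact le_log_add_sum_exp hγ hn (fun j => k₀ (y i j) (y i j)) hl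
  · have h1 := sq_sum_le_card_mul_sum_sq (s := Finset.Icc 1 n)
      (f := fun i => ‖(n : ℝ)⁻¹ • ∑ l ∈ Finset.Icc 1 n, ξ (y i l)‖)
    rw [Nat.card_Icc, Nat.add_sub_cancel] at h1
    rw [onlineBound]
    linarith

/-- The expectation of `onlineBound` is of order `n log n`. -/
theorem integral_onlineBound_le [IsMarkovKernel K] [IsProbabilityMeasure π]
    [IsProbabilityMeasure μ] {y : ℕ → ℕ → Ω → α}
    (hk : Measurable fun q : α × α => k₀ q.1 q.2) (hξ : ∀ x y, inner ℝ (ξ x) (ξ y) = k₀ x y)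
    (hγ : 0 < γ) (hn : 2 ≤ n) {A : ℝ} (hA : 0 ≤ A)
    (hmean : ∀ x, ∫ z, k₀ x z ∂π = 0) (hπ : Integrable (fun z => Real.exp (γ * k₀ z z)) π)
    (hVm : Measurable V) (hV1 : ∀ x, 1 ≤ V x) (hρ : 0 < ρ) (hρ1 : ρ < 1)
    (hE : ∀ (t : ℕ) (y : α), vDist V ((K ^ t) y) π ≤ R * V y * ENNReal.ofReal ρ ^ t)
    (hchain : ∀ i ∈ Finset.Icc 1 n, IsMarkovChain μ K n (y i))
    (hV0 : ∀ i ∈ Finset.Icc 1 n, ∫⁻ ω, V (y i 0 ω) ∂μ ≤ B)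
    (hexp : ∀ i ∈ Finset.Icc 1 n, ∀ l ∈ Finset.Icc 1 n,
      ∫⁻ ω, ENNReal.ofReal (Real.exp (γ * k₀ (y i l ω) (y i l ω))) ∂μ ≤ B) :
    Integrable (fun ω => onlineBound γ k₀ ξ A n fun i l => y i l ω) μ ∧
    ∫ ω, onlineBound γ k₀ ξ A n (fun i l => y i l ω) ∂μ ≤
      (4 * (A / Real.log 2 + (1 + B / Real.log 2) / γ) +
        2 * ((1 / Real.log 2 + 4 / γ) *
          (√(2 * R) * ((B / γ + (1 + 2 * R) * B) / 2) * (2 * (1 - √ρ)⁻¹)) +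
          (3 * B + ∫ z, Real.exp (γ * k₀ z z) ∂π) / γ / Real.log 2)) * (n * Real.log n) := by
  have hn0 : 0 < n := by omega
  have hn' : (0 : ℝ) < n := by exact_mod_cast hn0
  have hn1 : (1 : ℝ) ≤ n := by exact_mod_cast hn0
  have hlog2 : 0 < Real.log 2 := Real.log_pos (by norm_num)
  have hlog : Real.log 2 ≤ Real.log n := Real.log_le_log (by norm_num) (by exact_mod_cast hn)
  -- As `n ≥ 2`, this factor absorbs every constant term into a multiple of `log n`.
  have hone : 1 ≤ Real.log n / Real.log 2 := (one_le_div hlog2).mpr hlog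
  have hexpm : Measurable fun x => Real.exp (γ * k₀ x x) :=
    ((measurable_kernel_diag hk).const_mul γ).exp
  have hθ : √ρ < 1 := by
    rw [Real.sqrt_lt' one_pos]
    simpa using hρ1
  have hinv : 0 ≤ (1 - √ρ)⁻¹ := inv_nonneg.mpr (by linarith)
  have he : ∀ i ∈ Finset.Icc 1 n, ∀ l ∈ Finset.Icc 1 n,
      Integrable (fun ω => Real.exp (γ * k₀ (y i l ω) (y i l ω))) μ ∧
        ∫ ω, Real.exp (γ * k₀ (y i l ω) (y i l ω)) ∂μ ≤ B := fun i hi l hl =>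
    integrable_and_integral_le_of_lintegral_le
      (hexpm.comp ((hchain i hi).1 l (Finset.mem_Icc.mp hl).2)).aestronglyMeasurable
      (fun ω => (Real.exp_pos _).le) (hexp i hi l hl)
  have hb := fun i hi => (hchain i hi).integral_norm_mean_sq_le hk hξ hγ hn0 hmean hπ hVm hV1 hρ hρ1
    hE (hV0 i hi) (hexp i hi)
  set P := √(2 * R) * ((B / γ + (1 + 2 * R) * B) / 2) * (2 * (1 - √ρ)⁻¹) with hP
  set Q := (3 * B + ∫ z, Real.exp (γ * k₀ z z) ∂π) / γ with hQ
  have hP0 : 0 ≤ P := by positivity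
  have hQ0 : 0 ≤ Q := by
    have : 0 ≤ ∫ z, Real.exp (γ * k₀ z z) ∂π := integral_nonneg fun z => (Real.exp_pos _).le
    positivity
  have hsum : ∀ i ∈ Finset.Icc 1 n, Integrable (fun ω =>
      ∑ l ∈ Finset.Icc 1 n, Real.exp (γ * k₀ (y i l ω) (y i l ω))) μ := fun i hi =>
    integrable_finsetSum _ fun l hl => (he i hi l hl).1
  have ha : ∀ i ∈ Finset.Icc 1 n, Integrable (fun ω => (Real.log n +
      (∑ l ∈ Finset.Icc 1 n, Real.exp (γ * k₀ (y i l ω) (y i l ω))) / n) / γ) μ := fun i hi =>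
    ((integrable_const _).add ((hsum i hi).div_const _)).div_const _
  have ha' : ∀ i ∈ Finset.Icc 1 n, ∫ ω, (Real.log n +
      (∑ l ∈ Finset.Icc 1 n, Real.exp (γ * k₀ (y i l ω) (y i l ω))) / n) / γ ∂μ ≤
      (Real.log n + B) / γ := by
    intro i hi
    rw [integral_div, integral_add (integrable_const _) ((hsum i hi).div_const _), integral_div,
      integral_finsetSum _ fun l hl => (he i hi l hl).1]
    have h1 : (∑ l ∈ Finset.Icc 1 n, ∫ ω, Real.exp (γ * k₀ (y i l ω) (y i l ω)) ∂μ) / n ≤ B := by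
      rw [div_le_iff₀ hn']
      refine (Finset.sum_le_sum fun l hl => (he i hi l hl).2).trans_eq ?_
      simp [mul_comm]
    simp only [integral_const, probReal_univ, one_smul]
    gcongr
  have hi1 := integrable_finsetSum _ ha
  have hi2 := integrable_finsetSum _ fun i hi => (hb i hi).1
  have hi3 := (((integrable_const (μ := μ) A).add hi1).const_mul 4)
  have hi4 := (hi2.const_mul (n : ℝ)).const_mul 2
  refine ⟨hi3.add hi4, ?_⟩
  have hsplit : ∫ ω, onlineBound γ k₀ ξ A n (fun i l => y i l ω) ∂μ =
      4 * (A + ∑ i ∈ Finset.Icc 1 n, ∫ ω, (Real.log n +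
        (∑ l ∈ Finset.Icc 1 n, Real.exp (γ * k₀ (y i l ω) (y i l ω))) / n) / γ ∂μ) +
      2 * (n * ∑ i ∈ Finset.Icc 1 n,
        ∫ ω, ‖(n : ℝ)⁻¹ • ∑ l ∈ Finset.Icc 1 n, ξ (y i l ω)‖ ^ 2 ∂μ) := by
    rw [← integral_finsetSum _ ha, ← integral_finsetSum _ fun i hi => (hb i hi).1]
    simp only [onlineBound]
    refine (integral_add hi3 hi4).trans ?_
    rw [integral_const_mul, integral_const_mul, integral_const_mul]
    congr 2
    refine (integral_add (integrable_const _) hi1).trans ?_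
    simp
  rw [hsplit]
  have hs1 : ∑ i ∈ Finset.Icc 1 n, ∫ ω, (Real.log n +
      (∑ l ∈ Finset.Icc 1 n, Real.exp (γ * k₀ (y i l ω) (y i l ω))) / n) / γ ∂μ ≤
      n * ((Real.log n + B) / γ) := by
    refine (Finset.sum_le_sum ha').trans_eq ?_
    rw [Finset.sum_const, Nat.card_Icc, Nat.add_sub_cancel, nsmul_eq_mul]
  have hs2 : n * ∑ i ∈ Finset.Icc 1 n,
      ∫ ω, ‖(n : ℝ)⁻¹ • ∑ l ∈ Finset.Icc 1 n, ξ (y i l ω)‖ ^ 2 ∂μ ≤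
      n * (√(4 / γ * Real.log n) * P + Q) := by
    refine mul_le_mul_of_nonneg_left ((Finset.sum_le_sum fun i hi => (hb i hi).2).trans_eq ?_) hn'.le
    rw [Finset.sum_const, Nat.card_Icc, Nat.add_sub_cancel, nsmul_eq_mul, hP, hQ]
    field_simp
  have hsq : √(4 / γ * Real.log n) ≤ (1 / Real.log 2 + 4 / γ) * Real.log n := by
    have h0 : 0 ≤ 4 / γ * Real.log n := mul_nonneg (by positivity) (hlog2.le.trans hlog)
    have h1 : √(4 / γ * Real.log n) ≤ 1 + 4 / γ * Real.log n := by
      nlinarith [Real.sq_sqrt h0, sq_nonneg (√(4 / γ * Real.log n) - 1)]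
    have h2 : (1 / Real.log 2 + 4 / γ) * Real.log n =
        Real.log n / Real.log 2 + 4 / γ * Real.log n := by ring
    linarith
  have hB : (B : ℝ) ≤ B * (Real.log n / Real.log 2) := le_mul_of_one_le_right B.2 hone
  have hQ1 : Q ≤ Q * (Real.log n / Real.log 2) := le_mul_of_one_le_right hQ0 hone
  have hA1 : A ≤ A * (n * (Real.log n / Real.log 2)) :=
    le_mul_of_one_le_right hA (one_le_mul_of_one_le_of_one_le hn1 hone)
  calc _ ≤ 4 * (A * (n * (Real.log n / Real.log 2)) +
          n * ((Real.log n + B * (Real.log n / Real.log 2)) / γ)) +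
        2 * (n * ((1 / Real.log 2 + 4 / γ) * Real.log n * P + Q * (Real.log n / Real.log 2))) := by
        refine add_le_add ?_ ?_
        · have h1 : (n : ℝ) * ((Real.log n + B) / γ) ≤
            n * ((Real.log n + B * (Real.log n / Real.log 2)) / γ) := by gcongr
          linarith
        · refine mul_le_mul_of_nonneg_left (hs2.trans ?_) (by norm_num)
          gcongr
    _ = _ := by ring

end Online

/-! ### Assembly of the theorem -/

theorem mainTheorem3 {d : ℕ} (X : Set (EuclideanSpace ℝ (Fin d)))
    (p : EuclideanSpace ℝ (Fin d) → ℝ) (hp : IsTargetDensity X p)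
    (k : EuclideanSpace ℝ (Fin d) → EuclideanSpace ℝ (Fin d) → ℝ)
    (hk : IsBaseKernel X k) (hpk : InSteinClass X p k)
    -- exponential moment condition on the Stein kernel
    (γ : ℝ) (hγ : 0 < γ)
    (hb : ∫⁻ y, ENNReal.ofReal (Real.exp (γ * steinKernelOn X p k y y)) ∂(targetMeasure X p) < ∞)
    -- the `V`-uniformly ergodic transition kernel
    (K : Kernel X X) [IsMarkovKernel K] (V : X → ℝ≥0∞)
    (hV : IsVUniformlyErgodic K (targetMeasure X p) V)
    -- growth function, growth constant, initial dictionary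
    (f : ℕ → ℝ) (hf_pos : ∀ i, 2 ≤ i → 0 < f i)
    (hf : (fun i : ℕ => Real.sqrt (i * Real.log i)) =O[Filter.atTop] f)
    (c : ℝ) (hc : 0 < c) (D₀ : Multiset X)
    -- uniform bound on the moments of the candidate chains
    (B : ℝ≥0) :
    ∃ C : ℝ, 0 < C ∧
      ∀ (n : ℕ), 2 ≤ n →
      ∀ (Ω : Type*) [MeasurableSpace Ω] (μ : Measure Ω) [IsProbabilityMeasure μ]
        (y : ℕ → ℕ → Ω → X) (D : ℕ → Ω → Multiset X),
        -- the candidates of each step come from a chain with transition kernel `K`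
        (∀ i ∈ Finset.Icc 1 n, IsMarkovChain μ K n (y i)) →
        (∀ i ∈ Finset.Icc 1 n, ∫⁻ ω, V (y i 0 ω) ∂μ ≤ B) →
        (∀ i ∈ Finset.Icc 1 n, ∀ l ∈ Finset.Icc 1 n,
          ∫⁻ ω, ENNReal.ofReal
            (Real.exp (γ * steinKernelOn X p k (y i l ω) (y i l ω))) ∂μ ≤ B) →
        -- the dictionaries are produced by the algorithm with `n` candidates at each step
        (∀ᵐ ω ∂μ, IsOnlineKSDT (steinKernelOn X p k) D₀ (fun i => Real.log i / f i ^ 2) f n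
          (fun _ => n) (fun i l => y i l ω) (fun i => D i ω)) →
        -- growth of the dictionaries
        (∀ᵐ ω ∂μ, ∀ i ∈ Finset.Icc 1 n, c * f i ≤ (Multiset.card (D i ω) : ℝ)) →
        ∫⁻ ω, ENNReal.ofReal (ksd (steinKernelOn X p k) (D n ω) ^ 2) ∂μ ≤
          ENNReal.ofReal C *
            (ENNReal.ofReal (n * Real.log n / f n ^ 2) +
              ENNReal.ofReal (1 / (n * f n ^ 2)) *
                ∑ _i ∈ Finset.Icc 1 n,
                  vPlus (steinKernelOn X p k) V (searchRadius γ n n) *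
                    vMinus (steinKernelOn X p k) V (searchRadius γ n n)) := by
  have hX := hp.isOpen
  have := hp.isProbabilityMeasure
  have hm : Measurable fun q : X × X => steinKernelOn X p k q.1 q.2 :=
    hk.measurable_steinKernelOn hX
  obtain ⟨H, _, _, ξ, hξ⟩ := exists_steinKernelOn_featureMap (p := p) hX hk
  obtain ⟨hVm, hV1, R, ρ, hρ, hρ1, hE⟩ := hV
  have hexpm : Measurable fun x : X => Real.exp (γ * steinKernelOn X p k x x) :=
    ((measurable_kernel_diag hm).const_mul γ).exp
  have hπ : Integrable (fun x : X => Real.exp (γ * steinKernelOn X p k x x))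
      (targetMeasure X p) :=
    (lintegral_ofReal_ne_top_iff_integrable hexpm.aestronglyMeasurable
      (Eventually.of_forall fun x => (Real.exp_pos _).le)).mp hb.ne
  have hnn : ∀ x : X, 0 ≤ steinKernelOn X p k x x := fun x => by
    rw [← hξ]
    exact real_inner_self_nonneg
  have hdiag : Integrable (fun x : X => steinKernelOn X p k x x) (targetMeasure X p) :=
    (hπ.div_const γ).mono' (measurable_kernel_diag hm).aestronglyMeasurable
      (Eventually.of_forall fun x => by
        rw [Real.norm_of_nonneg (hnn x)]
        exact le_exp_div hγ _)
  have hmean := integral_steinKernelOn hp hk hpk hdiag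
  set A := featureEnergy ξ D₀ + ‖featureSum ξ D₀‖ ^ 2
  have hA : 0 ≤ A := add_nonneg (featureEnergy_nonneg D₀) (sq_nonneg _)
  have hlog2 : 0 < Real.log 2 := Real.log_pos (by norm_num)
  have hθ : √ρ < 1 := by
    rw [Real.sqrt_lt' one_pos]
    simpa using hρ1
  have hinv : 0 ≤ (1 - √ρ)⁻¹ := inv_nonneg.mpr (by linarith)
  have hBπ : 0 ≤ ∫ z, Real.exp (γ * steinKernelOn X p k z z) ∂(targetMeasure X p) :=
    integral_nonneg fun z => (Real.exp_pos _).le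
  -- The constant of `integral_onlineBound_le`, divided by `c ^ 2` from the growth bound on the
  -- dictionary.
  refine ⟨(4 * (A / Real.log 2 + (1 + B / Real.log 2) / γ) +
      2 * ((1 / Real.log 2 + 4 / γ) *
        (√(2 * R) * ((B / γ + (1 + 2 * R) * B) / 2) * (2 * (1 - √ρ)⁻¹)) +
        (3 * B + ∫ z, Real.exp (γ * steinKernelOn X p k z z) ∂(targetMeasure X p)) / γ /
          Real.log 2)) / c ^ 2, by positivity, ?_⟩
  intro n hn Ω _ μ _ y D hchain hV0 hexp halg hgrow
  obtain ⟨hInt, hle⟩ := integral_onlineBound_le hm hξ hγ hn hA hmean hπ hVm hV1 hρ hρ1 hE hchain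
    hV0 hexp
  have hfn := hf_pos n hn
  have hcf : 0 < c * f n := mul_pos hc hfn
  set C := 4 * (A / Real.log 2 + (1 + B / Real.log 2) / γ) +
      2 * ((1 / Real.log 2 + 4 / γ) *
        (√(2 * R) * ((B / γ + (1 + 2 * R) * B) / 2) * (2 * (1 - √ρ)⁻¹)) +
        (3 * B + ∫ z, Real.exp (γ * steinKernelOn X p k z z) ∂(targetMeasure X p)) / γ /
          Real.log 2)
  have hbound : ∀ᵐ ω ∂μ, ENNReal.ofReal (ksd (steinKernelOn X p k) (D n ω) ^ 2) ≤
      ENNReal.ofReal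
        (onlineBound γ (steinKernelOn X p k) ξ A n (fun i l => y i l ω) / (c * f n) ^ 2) := by
    filter_upwards [halg, hgrow] with ω hω hcard
    have h1 := hω.norm_featureSum_sq_le_onlineBound hξ hγ (by omega)
    have h2 := hcard n (by simp; omega)
    refine ENNReal.ofReal_le_ofReal ?_
    rw [ksd_sq hξ]
    exact div_le_div₀ ((sq_nonneg _).trans h1) h1 (by positivity)
      (pow_le_pow_left₀ hcf.le h2 2)
  have hnonneg : 0 ≤ᵐ[μ] fun ω =>
      onlineBound γ (steinKernelOn X p k) ξ A n (fun i l => y i l ω) / (c * f n) ^ 2 := by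
    filter_upwards [halg] with ω hω
    exact div_nonneg ((sq_nonneg _).trans
      (hω.norm_featureSum_sq_le_onlineBound hξ hγ (by omega))) (sq_nonneg _)
  calc ∫⁻ ω, ENNReal.ofReal (ksd (steinKernelOn X p k) (D n ω) ^ 2) ∂μ
      ≤ ∫⁻ ω, ENNReal.ofReal
        (onlineBound γ (steinKernelOn X p k) ξ A n (fun i l => y i l ω) / (c * f n) ^ 2) ∂μ :=
        lintegral_mono_ae hbound
    _ = ENNReal.ofReal (∫ ω,
        onlineBound γ (steinKernelOn X p k) ξ A n (fun i l => y i l ω) / (c * f n) ^ 2 ∂μ) :=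
        (ofReal_integral_eq_lintegral_ofReal (hInt.div_const _) hnonneg).symm
    _ ≤ ENNReal.ofReal (C / c ^ 2 * (n * Real.log n / f n ^ 2)) := by
        refine ENNReal.ofReal_le_ofReal ?_
        rw [integral_div]
        calc _ ≤ C * (n * Real.log n) / (c * f n) ^ 2 := by gcongr
          _ = _ := by rw [mul_pow, mul_div_mul_comm]
    _ = ENNReal.ofReal (C / c ^ 2) * ENNReal.ofReal (n * Real.log n / f n ^ 2) :=
        ENNReal.ofReal_mul (by positivity)
    -- The first summand suffices; the term with `vPlus` and `vMinus` is added as a nonnegative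
    -- quantity.
    _ ≤ _ := by
        gcongr
        exact le_self_add
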